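/- Let $k$ be an algebraically closed field and let $A=\bigoplus_{i\ge 0}A_i$ be a finite-dimensional positively graded $k$-algebra with $A_0$ semisimple. Let $\mathcal C$ be the category of finite-dimensional $A$-modules and suppose that $\mathcal C$ is a highest weight category with finite poset of weights $\Lambda$, with irreducible objects $L(\lambda)$, standard objects $\Delta(\lambda)$ and costandard objects $\nabla(\lambda)$ ($\lambda\in\Lambda$). Let $l:\Lambda\to\mathbb Z$ be a function (the length function), and write $\mathrm{Hom}^n(X,Y)=\mathrm{Hom}(X,Y[n])$ in $\mathcal D^b(\mathcal C)$. A finite-dimensional graded $A$-module $\widetilde M$ is a graded lift of $M\in\mathcal C$ if forgetting its grading gives a module isomorphic to $M$. It is linear if it has a graded projective resolution $\cdots\to P_1\to P_0\to\widetilde M\to 0$ with the head of $P_n$ homogeneous of grade $n$ for all $n\geq 0$, and colinear if it has a graded injective resolution $0\to\widetilde M\to I_0\to I_1\to\cdots$ with the socle of $I_n$ homogeneous of grade $-n$ for all $n\geq 0$. We call $A$ standard Koszul if, for each $\lambda\in\Lambda$, the graded lift of $\Delta(\lambda)$ with head in grade $0$ is linear and the graded lift of $\nabla(\lambda)$ with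 socle in grade $0$ is colinear. A module $M\in\mathcal C$ has parity if for each $\lambda\in\Lambda$ either $\mathrm{Ext}^n_{\mathcal C}(M,L(\lambda))=0$ for all odd $n$, or $\mathrm{Ext}^n_{\mathcal C}(M,L(\lambda))=0$ for all even $n$. Let $\mathcal E^R$ (respectively $\mathcal E^L$) be the union $\bigcup_i\mathcal E_i$ of the classes of objects of $\mathcal D^b(\mathcal C)$ defined as follows: $\mathcal E_0$ consists of the finite direct sums of objects $\nabla(\lambda)[l(\lambda)+2m]$ (respectively $\Delta(\lambda)[l(\lambda)+2m]$) with $\lambda\in\Lambda$, $m\in\mathbb Z$, and $X\in\mathcal E_{i+1}$ if and only if there is a distinguished triangle $X'\to X\to X''\to X'[1]$ with $X',X''\in\mathcal E_i$. The category $\mathcal C$ has a Kazhdan--Lusztig theory (with respect to $l$) if $L(\lambda)[l(\lambda)]\in\mathcal E^R\cap\mathcal E^L$ for all $\lambda\in\Lambda$. Suppose that $\mathrm{Ext}^1_{\mathcal C}(L(\lambda_1),L(\lambda_2))=0$ whenever $l(\lambda_1)\equiv l(\lambda_2)\pmod 2$. Then: 1. Let $M\in\mathcal C$ have a linear graded lift,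 and suppose that $M$ is indecomposable or that all irreducible quotients $L(\lambda)$ of $M$ have lengths $l(\lambda)$ of the same parity. Then $M$ has parity. 2. If $A$ is standard Koszul, then $\mathcal C$ has a Kazhdan--Lusztig theory. -/

import Mathlib

open CategoryTheory CategoryTheory.Limits CategoryTheory.Pretriangulated CategoryTheory.Abelian

universe w w' v u u'

noncomputable section

namespace HWParity

/-! ### Highest weight categories -/

section HighestWeight

variable {C : Type u} [Category.{v} C] [Abelian C]

/-- `S` is a subquotient of `X`. For `S` simple and `X` of finite length this says that `S` is a
composition factor of `X`. -/
def IsFactor (S X : C) : Prop :=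
  ∃ (N : C) (i : N ⟶ X) (p : N ⟶ S), Mono i ∧ Epi p

/-- `X` has a finite filtration all of whose sections satisfy `Q`. -/
inductive HasFiltration (Q : C → Prop) : C → Prop
  | zero (X : C) (hX : IsZero X) : HasFiltration Q X
  | step (S : ShortComplex C) (hS : S.ShortExact) (h₁ : HasFiltration Q S.X₁) (h₃ : Q S.X₃) :
      HasFiltration Q S.X₂

/-- The structure of a highest weight category (in the sense of Cline, Parshall and Scott) with
poset of weights `Λ` on an abelian category all of whose objects have finite length: a complete
irredundant family of simple objects `L lam`, costandard objects `nabla lam` and standard objects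
`Delta lam`. -/
structure HighestWeight (C : Type u) [Category.{v} C] [Abelian C]
    (Λ : Type u') [PartialOrder Λ] where
  /-- the irreducible objects -/
  L : Λ → C
  /-- the costandard objects -/
  nabla : Λ → C
  /-- the standard objects -/
  Delta : Λ → C
  simple (lam : Λ) : Simple (L lam)
  eq_of_iso (lam mu : Λ) : Nonempty (L lam ≅ L mu) → lam = mu
  complete (S : C) : Simple S → ∃ lam, Nonempty (S ≅ L lam)
  /-- the embedding of `L lam` in `nabla lam` -/
  incl (lam : Λ) : L lam ⟶ nabla lam
  mono_incl (lam : Λ) : Mono (incl lam)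
  lt_of_factor (lam mu : Λ) : IsFactor (L mu) (cokernel (incl lam)) → mu < lam
  /-- `L lam` has an injective envelope `I`, with a finite filtration that begins with `nabla lam`
  and whose other sections are of the form `nabla mu` with `lam < mu` -/
  exists_injective (lam : Λ) :
    ∃ (I : C) (e : L lam ⟶ I) (j : nabla lam ⟶ I),
      Injective I ∧ Mono e ∧ (∀ (Y : C) (g : I ⟶ Y), Mono (e ≫ g) → Mono g) ∧
      Mono j ∧
      HasFiltration (fun X => ∃ mu, lam < mu ∧ Nonempty (X ≅ nabla mu)) (cokernel j)
  /-- `Delta lam` is the projective cover of `L lam` in the Serre subcategory of the objects with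
  all composition factors of the form `L mu`, `mu ≤ lam` -/
  proj (lam : Λ) : Delta lam ⟶ L lam
  epi_proj (lam : Λ) : Epi (proj lam)
  essential_proj (lam : Λ) (Y : C) (g : Y ⟶ Delta lam) : Epi (g ≫ proj lam) → Epi g
  le_of_factor (lam mu : Λ) : IsFactor (L mu) (Delta lam) → mu ≤ lam
  lift_Delta (lam : Λ) (X Y : C) (f : X ⟶ Y) (g : Delta lam ⟶ Y) :
    Epi f → (∀ mu, IsFactor (L mu) X → mu ≤ lam) → ∃ h : Delta lam ⟶ X, h ≫ f = g

variable {Λ : Type u'} [PartialOrder Λ]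

/-- `M` has parity: for each irreducible `L lam`, either all `Ext^n(M, L lam)` with `n` odd vanish,
or all `Ext^n(M, L lam)` with `n` even vanish. -/
def HasParity [HasExt.{w} C] (H : HighestWeight C Λ) (M : C) : Prop :=
  ∀ lam : Λ, (∀ n : ℕ, Odd n → Subsingleton (Ext M (H.L lam) n)) ∨
    (∀ n : ℕ, Even n → Subsingleton (Ext M (H.L lam) n))

/-- All irreducible quotients of `M` have highest weights whose lengths have the same parity. -/
def HasHeadOfOneParity (H : HighestWeight C Λ) (l : Λ → ℤ) (M : C) : Prop :=
  ∀ (lam mu : Λ) (p : M ⟶ H.L lam) (q : M ⟶ H.L mu), Epi p → Epi q → l lam ≡ l mu [ZMOD 2]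

/-! ### Kazhdan-Lusztig theories -/

section Derived

variable [HasDerivedCategory.{w'} C]

/-- The object `M[n]` of the derived category, for `M` in `C`. -/
def shifted (M : C) (n : ℤ) : DerivedCategory C :=
  ((DerivedCategory.singleFunctor C 0).obj M)⟦n⟧

/-- The finite direct sums of the objects `(V lam)[l lam + 2 m]`, `m` an integer. -/
def E₀ (V : Λ → C) (l : Λ → ℤ) : ObjectProperty (DerivedCategory C) := fun X =>
  ∃ (r : ℕ) (lam : Fin r → Λ) (m : Fin r → ℤ),
    Nonempty (X ≅ ⨁ fun j => shifted (V (lam j)) (l (lam j) + 2 * m j))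

/-- The classes `E_i`: `X` is in `E_{i+1}` if there is a distinguished triangle
`X' ⟶ X ⟶ X'' ⟶ X'[1]` with `X'` and `X''` in `E_i`. -/
def E (V : Λ → C) (l : Λ → ℤ) : ℕ → ObjectProperty (DerivedCategory C)
  | 0 => E₀ V l
  | i + 1 => fun X => ∃ (X' X'' : DerivedCategory C) (f : X' ⟶ X) (g : X ⟶ X'')
      (h : X'' ⟶ X'⟦(1 : ℤ)⟧),
      Triangle.mk f g h ∈ (distTriang (DerivedCategory C)) ∧ E V l i X' ∧ E V l i X''

/-- The class `E^R`, built from the costandard objects. Its members have bounded cohomology, so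
that it lies in the bounded derived category. -/
def ER (H : HighestWeight C Λ) (l : Λ → ℤ) : ObjectProperty (DerivedCategory C) :=
  fun X => ∃ i, E H.nabla l i X

/-- The class `E^L`, built from the standard objects. -/
def EL (H : HighestWeight C Λ) (l : Λ → ℤ) : ObjectProperty (DerivedCategory C) :=
  fun X => ∃ i, E H.Delta l i X

/-- `C` has a Kazhdan-Lusztig theory: all `(L lam)[l lam]` lie in `E^R` and in `E^L`. -/
def HasKLTheory (H : HighestWeight C Λ) (l : Λ → ℤ) : Prop :=
  ∀ lam : Λ, ER H l (shifted (H.L lam) (l lam)) ∧ EL H l (shifted (H.L lam) (l lam))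

end Derived

end HighestWeight

/-! ### Graded modules, linearity, standard Koszulity -/

section Graded

variable {k : Type u'} [Field k] {A : Type u} [Ring A] [Algebra k A]

/-- A finitely generated `ℤ`-graded module over the graded algebra `A = ⨁ 𝒜 i`. The field `obj` is
the underlying ungraded module. -/
structure GrMod (𝒜 : ℕ → Submodule k A) where
  obj : FGModuleCat.{u} A
  /-- the component of grade `j` -/
  comp : ℤ → AddSubgroup obj
  isInternal : DirectSum.IsInternal comp
  smul_mem (i : ℕ) (j : ℤ) (a : A) (x : obj) : a ∈ 𝒜 i → x ∈ comp j → a • x ∈ comp (i + j)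

variable {𝒜 : ℕ → Submodule k A}

/-- `f` is a morphism of graded modules: it preserves grades. -/
def PreservesGrade (M N : GrMod 𝒜) (f : M.obj ⟶ N.obj) : Prop :=
  ∀ (j : ℤ) (x : M.obj), x ∈ M.comp j → f x ∈ N.comp j

/-- The head `M / rad M` is homogeneous of grade `i`: all components of other grades lie in the
radical. -/
def HeadInGrade (M : GrMod 𝒜) (i : ℤ) : Prop :=
  ∀ (j : ℤ) (x : M.obj), j ≠ i → x ∈ M.comp j → x ∈ Module.jacobson A M.obj

/-- The socle of `M` is homogeneous of grade `i`. -/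
def SocleInGrade (M : GrMod 𝒜) (i : ℤ) : Prop :=
  ∀ (x : M.obj), x ∈ sSup {S : Submodule A M.obj | IsSimpleModule A S} → x ∈ M.comp i

/-- `M` is linear: it has a projective resolution `⋯ ⟶ P 1 ⟶ P 0 ⟶ M ⟶ 0` by graded modules such
that the head of `P n` is homogeneous of grade `n`. (A finite-dimensional graded module is
projective among the graded modules if and only if the underlying module is projective.) -/
def IsLinear [IsNoetherianRing A] (M : GrMod 𝒜) : Prop :=
  ∃ (P : ℕ → GrMod 𝒜) (d : ∀ n, (P (n + 1)).obj ⟶ (P n).obj) (e : (P 0).obj ⟶ M.obj),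
    (∀ n, PreservesGrade (P (n + 1)) (P n) (d n)) ∧ PreservesGrade (P 0) M e ∧
    Function.Surjective e ∧ Function.Exact (d 0) e ∧
    (∀ n, Function.Exact (d (n + 1)) (d n)) ∧
    (∀ n, Projective (P n).obj) ∧ ∀ n : ℕ, HeadInGrade (P n) n

/-- `M` is colinear: it has an injective resolution `0 ⟶ M ⟶ I 0 ⟶ I 1 ⟶ ⋯` by graded modules such
that the socle of `I n` is homogeneous of grade `-n`. (A finite-dimensional graded module is
injective among the finite-dimensional graded modules if and only if the underlying module is
injective.) -/
def IsColinear [IsNoetherianRing A] (M : GrMod 𝒜) : Prop :=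
  ∃ (I : ℕ → GrMod 𝒜) (d : ∀ n, (I n).obj ⟶ (I (n + 1)).obj) (e : M.obj ⟶ (I 0).obj),
    (∀ n, PreservesGrade (I n) (I (n + 1)) (d n)) ∧ PreservesGrade M (I 0) e ∧
    Function.Injective e ∧ Function.Exact e (d 0) ∧
    (∀ n, Function.Exact (d n) (d (n + 1))) ∧
    (∀ n, Injective (I n).obj) ∧ ∀ n : ℕ, SocleInGrade (I n) (-n)

variable (𝒜) in
/-- `M` has a linear graded lift. -/
def HasLinearLift [IsNoetherianRing A] (M : FGModuleCat.{u} A) : Prop :=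
  ∃ D : GrMod 𝒜, Nonempty (D.obj ≅ M) ∧ IsLinear D

variable (𝒜) in
/-- Standard Koszulity: for each weight, the graded lift of the standard module with head in grade
`0` is linear, and the graded lift of the costandard module with socle in grade `0` is colinear. -/
def IsStandardKoszul [IsNoetherianRing A] {Λ : Type*} [PartialOrder Λ]
    (H : HighestWeight (FGModuleCat.{u} A) Λ) : Prop :=
  ∀ lam : Λ,
    (∃ D : GrMod 𝒜, Nonempty (D.obj ≅ H.Delta lam) ∧ HeadInGrade D 0 ∧ IsLinear D) ∧
    (∃ D : GrMod 𝒜, Nonempty (D.obj ≅ H.nabla lam) ∧ SocleInGrade D 0 ∧ IsColinear D)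

end Graded

end HWParity

end

/-! Let P be a linear resolution of M. The image of P_{n+1} in P_n lies in grades above n, hence in
the radical, so the resolution is minimal: a map from P_{n+1} to an irreducible L(μ) factors through
this image, and it extends to the part of P_n of grade at least n+1. If Ext^1(L(λ), L(μ)) were zero
for every L(λ) in the head of P_n, it would extend to all of P_n and so vanish on the radical
(`linear_step`). Thus the parity of the lengths in the heads alternates along the resolution once
the head of M has a single parity, and Ext^n(M, L(λ)), which is zero when Hom(P_n, L(λ)) is, obeys
the parity rule (`parity_of_isLinear`). Colinear modules are treated dually (`colinear_step`,
`parity_of_isColinear`).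

For indecomposable M, the projection of the head of P_0 onto its even part is lifted to P_0 and
replaced by its degree zero component. The vanishing of Ext^1 within a parity class makes it
preserve the image of P_1, so it induces an endomorphism of M that is the identity on even
irreducible quotients and zero on odd ones (`exists_endomorphism_of_presentation`). By Fitting's
lemma one of the two kinds is absent (`weights_of_indecomposable`).

For a standard Koszul algebra this bounds the parity of Ext^n(Δ(μ), L(λ)) and Ext^n(L(λ), ∇(μ)),
since Δ(μ) has head L(μ) and ∇(μ) has socle L(μ). To reach the classes E, write L(λ)[l(λ)] as an
iterated extension, a word, of shifted costandard (or standard) objects, of uncontrolled parity. A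
letter of extremal weight and least shift can be moved to the top unless a cancellation shortens the
word (`Word.exists_top`). Since Ext^n(Δ(μ), ∇(λ)) is zero unless μ = λ and n = 0, the top letter is
then detected by morphisms from or to the dual family, so its shift has the right parity, and the
condition passes to the rest of the word (`Word.recognition_right`, `Word.recognition_left`). -/

namespace HWParity

/-! ### Iterated extensions in triangulated categories -/

section Triangulated

variable {T : Type*} [Category* T] [Preadditive T] [HasZeroObject T] [HasShift T ℤ]
  [∀ n : ℤ, (shiftFunctor T n).Additive] [Pretriangulated T]

lemma distTriang_of_iso {X₁ X₂ X₃ Y₁ Y₂ Y₃ : T} {f : X₁ ⟶ X₂} {g : X₂ ⟶ X₃}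
    {h : X₃ ⟶ X₁⟦(1 : ℤ)⟧} (hT : Triangle.mk f g h ∈ distTriang T) {f' : Y₁ ⟶ Y₂} {g' : Y₂ ⟶ Y₃}
    {h' : Y₃ ⟶ Y₁⟦(1 : ℤ)⟧} (e₁ : Y₁ ≅ X₁) (e₂ : Y₂ ≅ X₂) (e₃ : Y₃ ≅ X₃)
    (h₁ : f' ≫ e₂.hom = e₁.hom ≫ f) (h₂ : g' ≫ e₃.hom = e₂.hom ≫ g)
    (h₃ : h' ≫ e₁.hom⟦(1 : ℤ)⟧' = e₃.hom ≫ h) : Triangle.mk f' g' h' ∈ distTriang T :=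
  isomorphic_distinguished _ hT _ (Triangle.isoMk _ _ e₁ e₂ e₃ h₁ h₂ h₃)

/-- A split distinguished triangle can be read backwards. -/
lemma exists_distTriang_swap {A Z B : T} {f : A ⟶ Z} {g : Z ⟶ B} {h : B ⟶ A⟦(1 : ℤ)⟧}
    (hT : Triangle.mk f g h ∈ distTriang T) (h0 : h = 0) :
    ∃ (s : B ⟶ Z) (r : Z ⟶ A), Triangle.mk s r (0 : A ⟶ B⟦(1 : ℤ)⟧) ∈ distTriang T := by
  obtain ⟨e, -, -⟩ := exists_iso_binaryBiproduct_of_distTriang _ hT h0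
  let e' : Z ≅ B ⊞ A := e ≪≫ biprod.braiding A B
  refine ⟨biprod.inl ≫ e'.inv, e'.hom ≫ biprod.snd, ?_⟩
  exact distTriang_of_iso (f := biprod.inl) (g := biprod.snd)
    (binaryBiproductTriangle_distinguished B A) (Iso.refl _) e' (Iso.refl _)
    (by simp) (by simp) (by simp)

/-- `Word O w X` means that `X` is an iterated extension of the objects `O a`, for `a` in the
list `w`; the head of the list is the topmost quotient. -/
inductive Word {ι : Type*} (O : ι → T) : List ι → T → Prop
  | nil (X : T) (hX : IsZero X) : Word O [] X
  | cons (a : ι) (w : List ι) (X' X : T) (f : X' ⟶ X) (g : X ⟶ O a) (h : O a ⟶ X'⟦(1 : ℤ)⟧)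
      (hT : Triangle.mk f g h ∈ distTriang T) (hw : Word O w X') : Word O (a :: w) X

variable {ι : Type*} {O : ι → T}

lemma word_nil_iff {X : T} : Word O [] X ↔ IsZero X :=
  ⟨fun h => by cases h; assumption, fun h => .nil _ h⟩

lemma word_cons_iff {a : ι} {w : List ι} {X : T} :
    Word O (a :: w) X ↔ ∃ (X' : T) (f : X' ⟶ X) (g : X ⟶ O a) (h : O a ⟶ X'⟦(1 : ℤ)⟧),
      Triangle.mk f g h ∈ distTriang T ∧ Word O w X' := by
  constructor
  · intro h
    cases h with
    | cons _ _ X' _ f g h hT hw => exact ⟨X', f, g, h, hT, hw⟩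
  · rintro ⟨X', f, g, h, hT, hw⟩
    exact .cons a w X' X f g h hT hw

lemma Word.of_iso {w : List ι} {X Y : T} (h : Word O w X) (e : X ≅ Y) : Word O w Y := by
  cases h with
  | nil _ hX => exact .nil _ (hX.of_iso e.symm)
  | cons a w X' _ f g h hT hw =>
    refine .cons a w X' Y (f ≫ e.hom) (e.inv ≫ g) h ?_ hw
    exact distTriang_of_iso hT (Iso.refl _) e.symm (Iso.refl _) (by simp) (by simp) (by simp)

lemma word_singleton (a : ι) : Word O [a] (O a) :=
  .cons a [] _ (O a) _ (𝟙 _) _ (contractible_distinguished₁ _) (.nil _ (isZero_zero _))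

/-! ### Long exact sequences for shifted triangles -/

section LES

variable {X₁ X₂ X₃ D : T} {f : X₁ ⟶ X₂} {g : X₂ ⟶ X₃} {h : X₃ ⟶ X₁⟦(1 : ℤ)⟧}

lemma exists_lift_shift₂ (hT : Triangle.mk f g h ∈ distTriang T) {n : ℤ} (x : D ⟶ X₂⟦n⟧)
    (hx : x ≫ g⟦n⟧' = 0) : ∃ y : D ⟶ X₁⟦n⟧, y ≫ f⟦n⟧' = x := by
  -- Shifting a triangle by `n` multiplies its morphisms by the sign (-1)^n, which the lift absorbs.
  have hx' : x ≫ (n.negOnePow • g⟦n⟧') = 0 := by simp [hx]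
  obtain ⟨y, hy⟩ : ∃ y : D ⟶ X₁⟦n⟧, x = y ≫ (n.negOnePow • f⟦n⟧') :=
    Triangle.coyoneda_exact₂ _ (Triangle.shift_distinguished _ hT n) x hx'
  exact ⟨n.negOnePow • y, by simp [hy]⟩

lemma eq_zero_of_shift₁ (hT : Triangle.mk f g h ∈ distTriang T) {n m : ℤ} (hm : m + 1 = n)
    (hD : ∀ z : D ⟶ X₃⟦m⟧, z = 0) (x : D ⟶ X₁⟦n⟧) (hx : x ≫ f⟦n⟧' = 0) : x = 0 := by
  obtain ⟨y, hy⟩ : ∃ y : D ⟶ X₃⟦(-1 : ℤ)⟧⟦n⟧,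
      y ≫ ((Triangle.mk f g h).invRotate.mor₁)⟦n⟧' = x :=
    exists_lift_shift₂ (inv_rot_of_distTriang _ hT) x hx
  let e : X₃⟦(-1 : ℤ)⟧⟦n⟧ ≅ X₃⟦m⟧ := (shiftFunctorAdd' T (-1) n m (by omega)).symm.app X₃
  have : y = 0 := by
    rw [← cancel_mono e.hom, zero_comp]
    exact hD _
  rw [← hy, this]
  exact zero_comp

lemma exists_lift_shift₃ (hT : Triangle.mk f g h ∈ distTriang T) {n m : ℤ} (hm : n + 1 = m)
    (hD : ∀ z : D ⟶ X₁⟦m⟧, z = 0) (x : D ⟶ X₃⟦n⟧) : ∃ y : D ⟶ X₂⟦n⟧, y ≫ g⟦n⟧' = x := by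
  suffices hx : x ≫ h⟦n⟧' = 0 from exists_lift_shift₂ (rot_of_distTriang _ hT) x hx
  let e : X₁⟦(1 : ℤ)⟧⟦n⟧ ≅ X₁⟦m⟧ := (shiftFunctorAdd' T 1 n m (by omega)).symm.app X₁
  rw [← cancel_mono e.hom, zero_comp]
  exact hD _

lemma exists_desc₁ (hT : Triangle.mk f g h ∈ distTriang T)
    (hD : ∀ z : X₃⟦(-1 : ℤ)⟧ ⟶ D, z = 0) (x : X₁ ⟶ D) : ∃ y : X₂ ⟶ D, f ≫ y = x := by
  obtain ⟨y, hy⟩ := Triangle.yoneda_exact₂ _ (inv_rot_of_distTriang _ hT) x (hD _)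
  exact ⟨y, hy.symm⟩

lemma eq_zero_of_desc₃ (hT : Triangle.mk f g h ∈ distTriang T)
    (hD : ∀ z : X₁⟦(1 : ℤ)⟧ ⟶ D, z = 0) (x : X₃ ⟶ D) (hx : g ≫ x = 0) : x = 0 := by
  obtain ⟨y, hy⟩ : ∃ y : X₁⟦(1 : ℤ)⟧ ⟶ D, x = h ≫ y := Triangle.yoneda_exact₃ _ hT x hx
  rw [hy, hD y, comp_zero]

end LES

lemma Word.hom_shift_eq_zero {D : T} {n : ℤ} {w : List ι} {X : T} (hX : Word O w X)
    (hw : ∀ a ∈ w, ∀ f : D ⟶ (O a)⟦n⟧, f = 0) (f : D ⟶ X⟦n⟧) : f = 0 := by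
  induction hX with
  | nil X hX => exact ((shiftFunctor T n).map_isZero hX).eq_of_tgt _ _
  | cons a w X' X p q h hT hX' ih =>
    obtain ⟨y, hy⟩ := exists_lift_shift₂ hT f (hw a (by simp) _)
    rw [← hy, ih (fun b hb => hw b (by simp [hb])) y, zero_comp]

lemma Word.hom_eq_zero {D : T} {w : List ι} {X : T} (hX : Word O w X)
    (hw : ∀ a ∈ w, ∀ f : O a ⟶ D, f = 0) (f : X ⟶ D) : f = 0 := by
  induction hX with
  | nil X hX => exact hX.eq_of_src _ _
  | cons a w X' X p q h hT hX' ih =>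
    obtain ⟨y, hy⟩ : ∃ y : O a ⟶ D, f = q ≫ y :=
      Triangle.yoneda_exact₂ _ hT f (ih (fun b hb => hw b (by simp [hb])) _)
    rw [hy, hw a (by simp) y, comp_zero]

variable [IsTriangulated T]

/-- Iterated extensions are closed under extensions. -/
lemma Word.append {v : List ι} : ∀ {u : List ι} {A B C : T} {f : A ⟶ B} {g : B ⟶ C}
    {h : C ⟶ A⟦(1 : ℤ)⟧}, Triangle.mk f g h ∈ distTriang T → Word O u C → Word O v A →
    Word O (u ++ v) B := by
  intro u
  induction u with
  | nil =>
    intro A B C f g h hT hC hA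
    have : IsIso f := (Triangle.isZero₃_iff_isIso₁ _ hT).1 (word_nil_iff.1 hC)
    exact hA.of_iso (asIso f)
  | cons c u ih =>
    intro A B C f g h hT hC hA
    obtain ⟨C', f', g', h', hT', hC'⟩ := word_cons_iff.1 hC
    obtain ⟨B', f'', h'', hT''⟩ := distinguished_cocone_triangle₁ (g ≫ g')
    -- The octahedron on B ⟶ C ⟶ O c presents the fibre B' of the composite as an extension of C' by
    -- A.
    have o := Triangulated.someOctahedron' (u₁₂ := g) (u₂₃ := g') rfl hT hT' hT''
    exact .cons c _ B' B _ _ _ hT'' (ih o.mem hC' hA)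

/-- Two adjacent letters can be interchanged or cancelled, if the connecting morphism is zero or
invertible. -/
lemma Word.swap {a b : ι} {w : List ι} {X : T} (hX : Word O (b :: a :: w) X)
    (hab : ∀ h : O b ⟶ (O a)⟦(1 : ℤ)⟧, h = 0 ∨ IsIso h) :
    Word O (a :: b :: w) X ∨ Word O w X := by
  obtain ⟨X', f₁, g₁, h₁, hT₁, hX'⟩ := word_cons_iff.1 hX
  obtain ⟨X'', f₂, g₂, h₂, hT₂, hX''⟩ := word_cons_iff.1 hX'
  obtain ⟨Z, v, k, hT⟩ := distinguished_cocone_triangle (f₂ ≫ f₁)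
  -- The cone Z of X'' ⟶ X is an extension of `O b` by `O a` with connecting morphism `h₁ ≫ g₂⟦1⟧'`.
  -- If that is zero, Z splits and its letters can be read in the other order; if it is invertible,
  -- Z is zero and X'' ≅ X.
  have o := Triangulated.someOctahedron (u₁₂ := f₂) (u₂₃ := f₁) rfl hT₂ hT₁ hT
  rcases hab (h₁ ≫ g₂⟦1⟧') with h0 | hiso
  · left
    obtain ⟨s, r, hsr⟩ := exists_distTriang_swap o.mem h0
    obtain ⟨Y, f, h, hY⟩ := distinguished_cocone_triangle₁ (v ≫ r)
    have o' := Triangulated.someOctahedron' (u₁₂ := v) (u₂₃ := r) rfl hT hsr hY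
    exact .cons a _ Y X _ _ _ hY (.cons b w X'' Y _ _ _ o'.mem hX'')
  · right
    have hZ : IsZero Z := (Triangle.isZero₂_iff_isIso₃ _ o.mem).2 hiso
    have : IsIso (f₂ ≫ f₁) := (Triangle.isZero₃_iff_isIso₁ _ hT).1 hZ
    exact hX''.of_iso (asIso (f₂ ≫ f₁))

/-- A letter can be moved to the top, or else the word can be shortened. -/
lemma Word.move {a : ι} {w : List ι} : ∀ {u : List ι} {X : T}, Word O (u ++ a :: w) X →
    (∀ b ∈ u, ∀ h : O b ⟶ (O a)⟦(1 : ℤ)⟧, h = 0 ∨ IsIso h) →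
    Word O (a :: (u ++ w)) X ∨ ∃ w', Word O w' X ∧ w'.length < (u ++ a :: w).length ∧
      ∀ b ∈ w', b ∈ u ++ a :: w := by
  intro u
  induction u with
  | nil => intro X hX _; exact .inl hX
  | cons b u ih =>
    intro X hX hu
    obtain ⟨X', f, g, h, hT, hX'⟩ := word_cons_iff.1 hX
    rcases ih hX' (fun c hc => hu c (by simp [hc])) with h1 | ⟨w', hw', hlen, hmem⟩
    · rcases (Word.cons b _ X' X f g h hT h1).swap (hu b (by simp)) with h2 | h2
      · exact .inl h2
      · refine .inr ⟨u ++ w, h2, by simp, fun c hc => ?_⟩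
        simp only [List.cons_append, List.mem_cons, List.mem_append] at hc ⊢
        tauto
    · refine .inr ⟨b :: w', .cons b _ X' X f g h hT hw', by simp at hlen ⊢; omega, ?_⟩
      intro c hc
      simp only [List.cons_append, List.mem_cons, List.mem_append] at hc hmem ⊢
      rcases hc with rfl | hc
      · exact .inl rfl
      · exact .inr (hmem c hc)

/-- A nonzero iterated extension of objects `O (lam, n)` has a top quotient `O a` such that the
remaining letters do not contain the predecessor of `a`. -/
lemma Word.exists_top {Λ : Type*} [Finite Λ] {O : Λ × ℤ → T} {r : Λ → Λ → Prop} [IsTrans Λ r]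
    [Std.Irrefl r]
    (hO : ∀ (a b : Λ × ℤ) (h : O b ⟶ (O a)⟦(1 : ℤ)⟧), h = 0 ∨ IsIso h ∨ r a.1 b.1) :
    ∀ (k : ℕ) (w : List (Λ × ℤ)) (X : T), w.length = k → Word O w X →
    IsZero X ∨ ∃ (a : Λ × ℤ) (w' : List (Λ × ℤ)), Word O (a :: w') X ∧ w'.length < k ∧
      (a.1, a.2 - 1) ∉ w' := by
  intro k
  induction k using Nat.strong_induction_on with
  | _ k ih =>
  intro w X hk hw
  by_cases hnil : w = []
  · subst hnil
    exact .inl (word_nil_iff.1 hw)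
  have hwf : WellFounded (fun x y : Λ => r y x) := Finite.wellFounded_of_trans_of_irrefl _
  -- No weight x of the word satisfies `r lam x`, so a letter of weight `lam` can pass, or cancel
  -- with, any letter above it. The least shift `n` is chosen so that `(lam, n - 1)` does not occur.
  obtain ⟨lam, hlam, hmax⟩ := hwf.has_min {x | ∃ n, (x, n) ∈ w} (by
    obtain ⟨a, ha⟩ := List.exists_mem_of_ne_nil w hnil
    exact ⟨a.1, a.2, ha⟩)
  obtain ⟨n, hn, hmin⟩ := Set.exists_min_image {n : ℤ | (lam, n) ∈ w} id
    ((w.finite_toSet.preimage (Prod.mk_right_injective lam).injOn)) hlam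
  obtain ⟨u, v, huv⟩ := List.append_of_mem hn
  subst huv
  have hmove : ∀ b ∈ u, ∀ h : O b ⟶ (O (lam, n))⟦(1 : ℤ)⟧, h = 0 ∨ IsIso h := fun b hb h => by
    rcases hO (lam, n) b h with h0 | h0 | h0
    · exact .inl h0
    · exact .inr h0
    · exact absurd h0 (hmax b.1 ⟨b.2, by simp [hb]⟩)
  rcases hw.move hmove with h1 | ⟨w', hw', hlen, -⟩
  · refine .inr ⟨(lam, n), u ++ v, h1, ?_, fun hmem => ?_⟩
    · simp at hk ⊢
      omega
    · have := hmin (n - 1) (by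
        simp only [List.mem_append, Set.mem_ofPred_eq, List.mem_cons] at hmem ⊢
        tauto)
      simp at this
  · rcases ih w'.length (hk ▸ hlen) w' X rfl hw' with h0 | ⟨a, w'', h1, h2, h3⟩
    · exact .inl h0
    · exact .inr ⟨a, w'', h1, by omega, h3⟩

/-! ### Recognition of an extension-closed class by a dual family -/

section Recognition

variable {Λ : Type*} [Finite Λ] {V D : Λ → T} {l : Λ → ℤ} {r : Λ → Λ → Prop} [IsTrans Λ r]
  [Std.Irrefl r] {G : T → Prop}

/-- Recognition by morphisms from a dual family. -/
theorem Word.recognition_right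
    (hV : ∀ (a b : Λ × ℤ) (h : (V b.1)⟦b.2⟧ ⟶ ((V a.1)⟦a.2⟧)⟦(1 : ℤ)⟧),
      h = 0 ∨ IsIso h ∨ r a.1 b.1)
    (hDV : ∀ (mu lam : Λ) (m n : ℤ) (f : D mu ⟶ ((V lam)⟦m⟧)⟦n⟧), f ≠ 0 → mu = lam ∧ n = -m)
    (hne : ∀ (lam : Λ) (m : ℤ), ∃ f : D lam ⟶ ((V lam)⟦m⟧)⟦-m⟧, f ≠ 0)
    (hG0 : ∀ X, IsZero X → G X) (hG1 : ∀ lam m, m ≡ l lam [ZMOD 2] → G ((V lam)⟦m⟧))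
    (hG2 : ∀ (X₁ X₂ X₃ : T) (f : X₁ ⟶ X₂) (g : X₂ ⟶ X₃) (h : X₃ ⟶ X₁⟦(1 : ℤ)⟧),
      Triangle.mk f g h ∈ distTriang T → G X₁ → G X₃ → G X₂) :
    ∀ (k : ℕ) (w : List (Λ × ℤ)) (X : T), w.length = k →
      Word (fun a : Λ × ℤ => (V a.1)⟦a.2⟧) w X →
      (∀ (mu : Λ) (n : ℤ) (f : D mu ⟶ X⟦n⟧), f ≠ 0 → n ≡ l mu [ZMOD 2]) → G X := by
  intro k
  induction k using Nat.strong_induction_on with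
  | _ k ih =>
  intro w X hk hw hX
  rcases Word.exists_top (O := fun a : Λ × ℤ => (V a.1)⟦a.2⟧) hV k w X hk hw with
    h0 | ⟨⟨lam, m⟩, w', h1, hlen, hnot⟩
  · exact hG0 X h0
  obtain ⟨X', f, g, h, hT, hX'⟩ := word_cons_iff.1 h1
  -- Only the letter `(lam, m - 1)` could receive such a morphism, and it is absent from `w'`.
  have hvan : ∀ z : D lam ⟶ X'⟦-m + 1⟧, z = 0 := hX'.hom_shift_eq_zero (fun a ha z => by
    by_contra hz
    obtain ⟨h1, h2⟩ := hDV _ _ _ _ z hz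
    apply hnot
    convert ha using 1
    ext
    · exact h1
    · simp only
      omega)
  refine hG2 _ _ _ _ _ _ hT (ih w'.length hlen w' X' rfl hX' ?_) (hG1 lam m ?_)
  · intro mu n x hx
    -- A morphism to X' that dies in X comes from `V lam` in degree n - 1. Duality allows this only
    -- for mu = lam and n = -m + 1, where `hvan` applies.
    by_cases hfx : x ≫ f⟦n⟧' = 0
    · exfalso
      by_cases hc : mu = lam ∧ n = -m + 1
      · obtain ⟨rfl, rfl⟩ := hc
        exact hx (hvan x)
      · refine hx (eq_zero_of_shift₁ hT (m := n - 1) (by omega) (fun z => ?_) x hfx)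
        by_contra hz
        obtain ⟨h1, h2⟩ := hDV _ _ _ _ z hz
        exact hc ⟨h1, by omega⟩
    · exact hX mu n _ hfx
  · obtain ⟨v, hv⟩ := hne lam m
    obtain ⟨y, hy⟩ := exists_lift_shift₃ hT (n := -m) rfl hvan v
    have := hX lam (-m) y (by
      rintro rfl
      exact hv (by rw [← hy, zero_comp]))
    have h2 : -m ≡ m [ZMOD 2] := Int.modEq_iff_dvd.2 ⟨m, by ring⟩
    exact h2.symm.trans this

/-- Recognition by morphisms to a dual family. -/
theorem Word.recognition_left
    (hV : ∀ (a b : Λ × ℤ) (h : (V b.1)⟦b.2⟧ ⟶ ((V a.1)⟦a.2⟧)⟦(1 : ℤ)⟧),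
      h = 0 ∨ IsIso h ∨ r a.1 b.1)
    (hDV : ∀ (mu lam : Λ) (m n : ℤ) (f : (V lam)⟦m⟧ ⟶ (D mu)⟦n⟧), f ≠ 0 → mu = lam ∧ n = m)
    (hne : ∀ (lam : Λ) (m : ℤ), ∃ f : (V lam)⟦m⟧ ⟶ (D lam)⟦m⟧, f ≠ 0)
    (hG0 : ∀ X, IsZero X → G X) (hG1 : ∀ lam m, m ≡ l lam [ZMOD 2] → G ((V lam)⟦m⟧))
    (hG2 : ∀ (X₁ X₂ X₃ : T) (f : X₁ ⟶ X₂) (g : X₂ ⟶ X₃) (h : X₃ ⟶ X₁⟦(1 : ℤ)⟧),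
      Triangle.mk f g h ∈ distTriang T → G X₁ → G X₃ → G X₂) :
    ∀ (k : ℕ) (w : List (Λ × ℤ)) (X : T), w.length = k →
      Word (fun a : Λ × ℤ => (V a.1)⟦a.2⟧) w X →
      (∀ (mu : Λ) (n : ℤ) (f : X ⟶ (D mu)⟦n⟧), f ≠ 0 → n ≡ l mu [ZMOD 2]) → G X := by
  intro k
  induction k using Nat.strong_induction_on with
  | _ k ih =>
  intro w X hk hw hX
  rcases Word.exists_top (O := fun a : Λ × ℤ => (V a.1)⟦a.2⟧) hV k w X hk hw with
    h0 | ⟨⟨lam, m⟩, w', h1, hlen, hnot⟩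
  · exact hG0 X h0
  obtain ⟨X', f, g, h, hT, hX'⟩ := word_cons_iff.1 h1
  have hvan : ∀ z : X' ⟶ (D lam)⟦m - 1⟧, z = 0 := hX'.hom_eq_zero (fun a ha z => by
    by_contra hz
    obtain ⟨h1, h2⟩ := hDV _ _ _ _ z hz
    apply hnot
    convert ha using 1
    ext
    · exact h1
    · exact h2)
  refine hG2 _ _ _ _ _ _ hT (ih w'.length hlen w' X' rfl hX' ?_) (hG1 lam m ?_)
  · intro mu n x hx
    by_cases hc : mu = lam ∧ n = m - 1
    · obtain ⟨rfl, rfl⟩ := hc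
      exact absurd (hvan x) hx
    -- The obstruction to extending x to X is a morphism from the top letter shifted by -1; it can
    -- be nonzero only in the case just excluded.
    · obtain ⟨y, hy⟩ := exists_desc₁ hT (fun z => by
        let e : (V lam)⟦m⟧⟦(-1 : ℤ)⟧ ≅ (V lam)⟦m - 1⟧ :=
          (shiftFunctorAdd' T m (-1) (m - 1) (by omega)).symm.app (V lam)
        by_contra hz
        obtain ⟨h1, h2⟩ := hDV mu lam (m - 1) n (e.inv ≫ z) (fun h0 => hz (by
          rw [← cancel_epi e.inv, h0, comp_zero]))
        exact hc ⟨h1, h2⟩) x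
      refine hX mu n y ?_
      rintro rfl
      exact hx (by rw [← hy, comp_zero])
  · obtain ⟨v, hv⟩ := hne lam m
    -- If g ≫ v were zero, v would factor through X'[1], whose morphisms to D lam[m] are shifts of
    -- those killed by `hvan`.
    refine hX lam m (g ≫ v) (fun h0 => hv (eq_zero_of_desc₃ hT (fun z => ?_) v h0))
    let e : (D lam)⟦m - 1⟧⟦(1 : ℤ)⟧ ≅ (D lam)⟦m⟧ :=
      (shiftFunctorAdd' T (m - 1) 1 m (by omega)).symm.app (D lam)
    obtain ⟨z', hz'⟩ := (shiftFunctor T (1 : ℤ)).map_surjective (z ≫ e.inv)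
    rw [← cancel_mono e.inv, ← hz', hvan z', Functor.map_zero, zero_comp]

end Recognition

end Triangulated

/-! ### Vanishing of Ext, composition factors, highest weight categories -/

section AbelianLemmas

variable {C : Type u} [Category.{v} C] [Abelian C]

section ExtVanishing

variable [HasExt.{w} C] {S : ShortComplex C} {X Y : C} {n : ℕ}

lemma ext_zero_eq_zero (h : ∀ f : X ⟶ Y, f = 0) (x : Ext X Y 0) : x = 0 := by
  obtain ⟨f, rfl⟩ := Ext.mk₀_bijective (X := X) (Y := Y) |>.2 x
  rw [h f, Ext.mk₀_zero]

lemma ext_eq_zero_of_iso_right {Y' : C} (e : Y ≅ Y') (h : ∀ x : Ext X Y n, x = 0)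
    (x : Ext X Y' n) : x = 0 := by
  have : x = (x.comp (Ext.mk₀ e.inv) (add_zero n)).comp (Ext.mk₀ e.hom) (add_zero n) := by
    simp [Ext.comp_assoc_of_second_deg_zero]
  rw [this, h (x.comp _ _), Ext.zero_comp]

lemma ext_eq_zero_of_iso_left {X' : C} (e : X ≅ X') (h : ∀ x : Ext X Y n, x = 0)
    (x : Ext X' Y n) : x = 0 := by
  have : x = (Ext.mk₀ e.inv).comp ((Ext.mk₀ e.hom).comp x (zero_add n)) (zero_add n) := by
    simp
  rw [this, h (Ext.comp _ x _), Ext.comp_zero]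

lemma ext_eq_zero_of_isZero_left (hX : IsZero X) (x : Ext X Y n) : x = 0 := by
  have : x = (Ext.mk₀ (𝟙 X)).comp x (zero_add n) := by simp
  rw [this, hX.eq_of_src (𝟙 X) 0]
  simp

lemma ext_eq_zero_of_isZero_right (hY : IsZero Y) (x : Ext X Y n) : x = 0 := by
  have : x = x.comp (Ext.mk₀ (𝟙 Y)) (add_zero n) := by simp
  rw [this, hY.eq_of_src (𝟙 Y) 0]
  simp

lemma ext_eq_zero_mid_right (hS : S.ShortExact) (h₁ : ∀ x : Ext X S.X₁ n, x = 0)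
    (h₃ : ∀ x : Ext X S.X₃ n, x = 0) (x : Ext X S.X₂ n) : x = 0 := by
  obtain ⟨y, rfl⟩ := Ext.covariant_sequence_exact₂ X hS x (h₃ _)
  rw [h₁ y, Ext.zero_comp]

lemma ext_eq_zero_mid_left (hS : S.ShortExact) (h₁ : ∀ x : Ext S.X₁ Y n, x = 0)
    (h₃ : ∀ x : Ext S.X₃ Y n, x = 0) (x : Ext S.X₂ Y n) : x = 0 := by
  obtain ⟨y, rfl⟩ := Ext.contravariant_sequence_exact₂ hS Y x (h₁ _)
  rw [h₃ y, Ext.comp_zero]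

lemma ext_eq_zero_left_end (hS : S.ShortExact) (h₃ : ∀ x : Ext X S.X₃ n, x = 0)
    (h₂ : ∀ x : Ext X S.X₂ (n + 1), x = 0) (x : Ext X S.X₁ (n + 1)) : x = 0 := by
  obtain ⟨y, rfl⟩ := Ext.covariant_sequence_exact₁ X hS x (h₂ _) rfl
  rw [h₃ y, Ext.zero_comp]

lemma ext_eq_zero_right_end (hS : S.ShortExact) (h₁ : ∀ x : Ext S.X₁ Y n, x = 0)
    (h₂ : ∀ x : Ext S.X₂ Y (n + 1), x = 0) (x : Ext S.X₃ Y (n + 1)) : x = 0 := by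
  obtain ⟨y, rfl⟩ := Ext.contravariant_sequence_exact₃ hS Y x (h₂ _) (add_comm 1 n)
  rw [h₁ y, Ext.comp_zero]

lemma exists_extension (hS : S.ShortExact) (h : ∀ x : Ext S.X₃ Y 1, x = 0) (f : S.X₁ ⟶ Y) :
    ∃ g : S.X₂ ⟶ Y, S.f ≫ g = f := by
  obtain ⟨y, hy⟩ := Ext.contravariant_sequence_exact₁ hS Y (Ext.mk₀ f) rfl (h _)
  obtain ⟨g, rfl⟩ := Ext.mk₀_bijective (X := S.X₂) (Y := Y) |>.2 y
  refine ⟨g, (Ext.mk₀_bijective _ _).1 ?_⟩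
  rw [← hy, Ext.mk₀_comp_mk₀]

lemma exists_lifting (hS : S.ShortExact) (h : ∀ x : Ext X S.X₁ 1, x = 0) (f : X ⟶ S.X₃) :
    ∃ g : X ⟶ S.X₂, g ≫ S.g = f := by
  obtain ⟨y, hy⟩ := Ext.covariant_sequence_exact₃ X hS (Ext.mk₀ f) rfl (h _)
  obtain ⟨g, rfl⟩ := Ext.mk₀_bijective (X := X) (Y := S.X₂) |>.2 y
  refine ⟨g, (Ext.mk₀_bijective _ _).1 ?_⟩
  rw [← hy, Ext.mk₀_comp_mk₀]

/-- Since Ext^1(X, X₂) = 0, every class comes from a morphism X ⟶ X₃ by the connecting map, which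
kills the morphisms that lift to X₂. -/
lemma ext_one_eq_zero_of_lifting (hS : S.ShortExact) (h₂ : ∀ x : Ext X S.X₂ 1, x = 0)
    (h : ∀ f : X ⟶ S.X₃, ∃ g : X ⟶ S.X₂, g ≫ S.g = f) (x : Ext X S.X₁ 1) : x = 0 := by
  obtain ⟨y, rfl⟩ := Ext.covariant_sequence_exact₁ X hS x (h₂ _) (zero_add 1)
  obtain ⟨f, rfl⟩ := Ext.mk₀_bijective (X := X) (Y := S.X₃) |>.2 y
  obtain ⟨g, rfl⟩ := h f
  rw [← Ext.mk₀_comp_mk₀_assoc, hS.comp_extClass, Ext.comp_zero]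

lemma ext_eq_zero_of_hasFiltration {Q : C → Prop} (hY : HasFiltration Q Y)
    (hQ : ∀ Z, Q Z → ∀ x : Ext X Z n, x = 0) : ∀ x : Ext X Y n, x = 0 := by
  induction hY with
  | zero Y hY => exact ext_eq_zero_of_isZero_right hY
  | step S hS h₁ h₃ ih => exact ext_eq_zero_mid_right hS ih (hQ _ h₃)

end ExtVanishing

lemma shortExact_cokernel {X Y : C} (f : X ⟶ Y) [Mono f] :
    (ShortComplex.mk f (cokernel.π f) (cokernel.condition f)).ShortExact where
  exact := ShortComplex.exact_cokernel f
  mono_f := by assumption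
  epi_g := by dsimp; infer_instance

lemma shortExact_kernel {X Y : C} (f : X ⟶ Y) [Epi f] :
    (ShortComplex.mk (kernel.ι f) f (kernel.condition f)).ShortExact where
  exact := ShortComplex.exact_kernel f
  mono_f := by dsimp; infer_instance
  epi_g := by assumption

/-! ### Composition factors -/

omit [Abelian C] in
lemma IsFactor.of_mono {S X Y : C} (h : IsFactor S X) (f : X ⟶ Y) [Mono f] : IsFactor S Y := by
  obtain ⟨N, i, p, hi, hp⟩ := h
  exact ⟨N, i ≫ f, p, mono_comp _ _, hp⟩

lemma IsFactor.of_epi {S X Y : C} (h : IsFactor S Y) (f : X ⟶ Y) [Epi f] : IsFactor S X := by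
  obtain ⟨N, i, p, hi, hp⟩ := h
  exact ⟨pullback f i, pullback.fst f i, pullback.snd f i ≫ p, inferInstance, epi_comp _ _⟩

omit [Abelian C] in
lemma IsFactor.of_iso {S S' X : C} (h : IsFactor S X) (e : S ≅ S') : IsFactor S' X := by
  obtain ⟨N, i, p, hi, hp⟩ := h
  exact ⟨N, i, p ≫ e.hom, hi, epi_comp _ _⟩

omit [Abelian C] in
lemma isFactor_of_mono {S X : C} (f : S ⟶ X) [Mono f] : IsFactor S X :=
  ⟨S, f, 𝟙 S, inferInstance, inferInstance⟩

lemma IsFactor.nonempty_iso {S S' : C} [Simple S] [Simple S'] (h : IsFactor S S') :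
    Nonempty (S ≅ S') := by
  obtain ⟨N, i, p, hi, hp⟩ := h
  have hi0 : i ≠ 0 := by
    rintro rfl
    have hN : IsZero N := IsZero.of_mono_zero N S'
    exact Simple.not_isZero S (IsZero.of_epi p hN)
  have := isIso_of_mono_of_nonzero hi0
  have hp0 : inv i ≫ p ≠ 0 := by
    intro h0
    have : p = 0 := by rw [← cancel_epi (inv i), h0, comp_zero]
    subst this
    exact Simple.not_isZero S (IsZero.of_epi_zero N S)
  have := isIso_of_hom_simple hp0
  exact ⟨(asIso (inv i ≫ p)).symm⟩

/-- A morphism that vanishes on the kernel of `f` factors through the image of `f`. -/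
lemma exists_image_desc {X Y Z : C} (f : X ⟶ Y) (p : X ⟶ Z) (h : kernel.ι f ≫ p = 0) :
    ∃ d : Limits.image f ⟶ Z, factorThruImage f ≫ d = p := by
  refine ⟨Abelian.epiDesc (factorThruImage f) p ?_, Abelian.comp_epiDesc _ _ _⟩
  have hk : kernel.ι (factorThruImage f) ≫ f = 0 := by
    have h2 := kernel.condition_assoc (factorThruImage f) (Limits.image.ι f)
    rwa [Limits.image.fac, zero_comp] at h2
  have : kernel.ι (factorThruImage f) = kernel.lift f (kernel.ι (factorThruImage f)) hk ≫
      kernel.ι f := by simp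
  rw [this, Category.assoc, h, comp_zero]

/-- For N ⊆ X₂ mapping onto the simple object S, either N ∩ X₁ still maps onto S, or the map to S
factors through the image of N in X₃. -/
lemma IsFactor.of_shortExact {S : C} [Simple S] {K : ShortComplex C} (hK : K.ShortExact)
    (h : IsFactor S K.X₂) : IsFactor S K.X₁ ∨ IsFactor S K.X₃ := by
  obtain ⟨N, i, p, hi, hp⟩ := h
  by_cases h0 : kernel.ι (i ≫ K.g) ≫ p = 0
  · right
    obtain ⟨d, hd⟩ := exists_image_desc _ p h0
    have : Epi d := epi_of_epi_fac hd
    exact ⟨_, Limits.image.ι (i ≫ K.g), d, inferInstance, this⟩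
  · left
    have := hK.mono_f
    have hz : (kernel.ι (i ≫ K.g) ≫ i) ≫ K.g = 0 := by
      rw [Category.assoc, kernel.condition]
    have hfac := hK.exact.lift_f _ hz
    have : Mono (hK.exact.lift _ hz ≫ K.f) := by
      rw [hfac]
      exact mono_comp _ _
    exact ⟨_, hK.exact.lift _ hz, kernel.ι (i ≫ K.g) ≫ p, mono_of_mono _ K.f,
      epi_of_nonzero_to_simple h0⟩

/-! ### Length functions -/

/-- `ℓ` is additive on short exact sequences and positive on nonzero objects. -/
structure IsLengthFunction (ℓ : C → ℕ) : Prop where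
  add (S : ShortComplex C) : S.ShortExact → ℓ S.X₂ = ℓ S.X₁ + ℓ S.X₃
  isZero (X : C) : ℓ X = 0 → IsZero X

namespace IsLengthFunction

variable {ℓ : C → ℕ} (hℓ : IsLengthFunction ℓ)
include hℓ

lemma isIso_of_mono {X Y : C} (f : X ⟶ Y) [Mono f] (h : ℓ Y ≤ ℓ X) : IsIso f := by
  have h1 : ℓ Y = ℓ X + ℓ (cokernel f) := hℓ.add _ (shortExact_cokernel f)
  have h2 : IsZero (cokernel f) := hℓ.isZero _ (by omega)
  have : Epi f := Preadditive.epi_of_isZero_cokernel f h2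
  exact isIso_of_mono_of_epi f

lemma isIso_of_epi {X Y : C} (f : X ⟶ Y) [Epi f] (h : ℓ X ≤ ℓ Y) : IsIso f := by
  have h1 : ℓ X = ℓ (kernel f) + ℓ Y := hℓ.add _ (shortExact_kernel f)
  have h2 : IsZero (kernel f) := hℓ.isZero _ (by omega)
  have : Mono f := Preadditive.mono_of_isZero_kernel f h2
  exact isIso_of_mono_of_epi f

/-- A nonzero subobject of least length is simple. -/
lemma exists_simple_mono {X : C} (hX : ¬ IsZero X) :
    ∃ (S : C) (f : S ⟶ X), Simple S ∧ Mono f := by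
  classical
  have hex : ∃ n, ∃ (S : C) (f : S ⟶ X), ℓ S = n ∧ ¬ IsZero S ∧ Mono f :=
    ⟨_, X, 𝟙 X, rfl, hX, inferInstance⟩
  obtain ⟨S, f, hn, hS, hf⟩ := Nat.find_spec hex
  refine ⟨S, f, ⟨fun {Y} g hg => ⟨fun hiso h0 => ?_, fun h0 => ?_⟩⟩, hf⟩
  · subst h0
    exact hS (IsZero.of_epi_zero Y S)
  · have hY : ¬ IsZero Y := fun hY => h0 (hY.eq_of_src _ _)
    have := Nat.find_min' hex ⟨Y, g ≫ f, rfl, hY, mono_comp _ _⟩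
    exact hℓ.isIso_of_mono g (by omega)

/-- Induction over the composition factors. -/
lemma devissage {P : C → Prop} (hzero : ∀ X, IsZero X → P X)
    (hext : ∀ S : ShortComplex C, S.ShortExact → P S.X₁ → P S.X₃ → P S.X₂) (X : C)
    (hX : ∀ S, Simple S → IsFactor S X → P S) : P X := by
  induction hn : ℓ X using Nat.strong_induction_on generalizing X with
  | _ n ih =>
  by_cases h0 : IsZero X
  · exact hzero X h0
  obtain ⟨S, f, hS, hf⟩ := hℓ.exists_simple_mono h0
  have h1 : ℓ X = ℓ S + ℓ (cokernel f) := hℓ.add _ (shortExact_cokernel f)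
  have h2 : ℓ S ≠ 0 := fun h => Simple.not_isZero S (hℓ.isZero _ h)
  refine hext _ (shortExact_cokernel f) (hX S hS (isFactor_of_mono f)) ?_
  exact ih (ℓ (cokernel f)) (by omega) _
    (fun T hT h => hX T hT (h.of_epi (cokernel.π f))) rfl

end IsLengthFunction

/-! ### Highest weight categories -/

namespace HighestWeight

variable {Λ : Type u'} [PartialOrder Λ] (H : HighestWeight C Λ)

instance (lam : Λ) : Simple (H.L lam) := H.simple lam
instance (lam : Λ) : Mono (H.incl lam) := H.mono_incl lam
instance (lam : Λ) : Epi (H.proj lam) := H.epi_proj lam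

variable {H}

lemma eq_of_isFactor_L {lam mu : Λ} (h : IsFactor (H.L lam) (H.L mu)) : lam = mu :=
  H.eq_of_iso _ _ h.nonempty_iso

lemma eq_of_hom_L {lam mu : Λ} {f : H.L lam ⟶ H.L mu} (hf : f ≠ 0) : lam = mu :=
  have := isIso_of_hom_simple hf
  H.eq_of_iso _ _ ⟨asIso f⟩

lemma incl_ne_zero (lam : Λ) : H.incl lam ≠ 0 := fun h =>
  Simple.not_isZero (H.L lam) (by
    have := H.mono_incl lam
    rw [h] at this
    exact IsZero.of_mono_zero _ (H.nabla lam))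

lemma proj_ne_zero (lam : Λ) : H.proj lam ≠ 0 := fun h =>
  Simple.not_isZero (H.L lam) (by
    have := H.epi_proj lam
    rw [h] at this
    exact IsZero.of_epi_zero (H.Delta lam) _)

lemma le_of_isFactor_nabla {lam mu : Λ} (h : IsFactor (H.L mu) (H.nabla lam)) : mu ≤ lam := by
  rcases h.of_shortExact (shortExact_cokernel (H.incl lam)) with h | h
  · exact (eq_of_isFactor_L h).le
  · exact (H.lt_of_factor _ _ h).le

/-- If `proj lam` kills the kernel of `f`, it factors through the image of `f`. Otherwise that
kernel maps onto the head, so it is all of `Delta lam` by essentiality, and `f` is zero. -/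
lemma isFactor_of_hom_Delta {lam : Λ} {X : C} {f : H.Delta lam ⟶ X} (hf : f ≠ 0) :
    IsFactor (H.L lam) X := by
  by_cases h0 : kernel.ι f ≫ H.proj lam = 0
  · obtain ⟨d, hd⟩ := exists_image_desc _ _ h0
    exact ⟨_, Limits.image.ι f, d, inferInstance, epi_of_epi_fac hd⟩
  · have : Epi (kernel.ι f) := H.essential_proj _ _ _ (epi_of_nonzero_to_simple h0)
    exact absurd (by rw [← cancel_epi (kernel.ι f), kernel.condition, comp_zero]) hf

/-- The socle of `nabla lam` is `L lam`. -/
lemma eq_of_hom_L_nabla {lam mu : Λ} {f : H.L mu ⟶ H.nabla lam} (hf : f ≠ 0) : mu = lam := by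
  obtain ⟨I, e, j, -, he, hess, hj, -⟩ := H.exists_injective lam
  have hf' : Mono f := mono_of_nonzero_from_simple hf
  -- Nothing relates `incl lam` to `e`, so the comparison is made inside I: either `e` factors
  -- through the simple subobject `L mu`, or it remains mono modulo `L mu`, and then essentiality
  -- makes the quotient map mono.
  have hfj : Mono (f ≫ j) := mono_comp _ _
  by_cases h0 : e ≫ cokernel.π (f ≫ j) = 0
  · have hl : (Abelian.monoLift (f ≫ j) e h0) ≫ f ≫ j = e := Abelian.monoLift_comp _ _ _
    refine (eq_of_hom_L (f := Abelian.monoLift (f ≫ j) e h0) ?_).symm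
    intro h1
    rw [h1, zero_comp] at hl
    subst hl
    exact Simple.not_isZero (H.L lam) (IsZero.of_mono_zero _ I)
  · have h1 : Mono (cokernel.π (f ≫ j)) := hess _ _ (mono_of_nonzero_from_simple h0)
    have h2 : f ≫ j = 0 := by rw [← cancel_mono (cokernel.π (f ≫ j)), cokernel.condition, zero_comp]
    exact absurd (by rw [← cancel_mono j, h2, zero_comp]) hf

section Length

variable {ℓ : C → ℕ} (hℓ : IsLengthFunction ℓ)
include hℓ

lemma devissage {P : C → Prop} (hzero : ∀ X, IsZero X → P X)
    (hext : ∀ S : ShortComplex C, S.ShortExact → P S.X₁ → P S.X₃ → P S.X₂)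
    (hiso : ∀ X Y, (X ≅ Y) → P X → P Y) (X : C)
    (hX : ∀ lam, IsFactor (H.L lam) X → P (H.L lam)) : P X := by
  refine hℓ.devissage hzero hext X fun S hS hSX => ?_
  obtain ⟨lam, ⟨e⟩⟩ := H.complete S hS
  exact hiso _ _ e.symm (hX lam (hSX.of_iso e))

lemma isFactor_of_hom_nabla {lam : Λ} {X : C} {f : X ⟶ H.nabla lam} (hf : f ≠ 0) :
    IsFactor (H.L lam) X := by
  have h0 : ¬ IsZero (Limits.image f) := fun h => hf (by
    rw [← Limits.image.fac f, h.eq_of_src (Limits.image.ι f) 0, comp_zero])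
  obtain ⟨S, g, hS, hg⟩ := hℓ.exists_simple_mono h0
  obtain ⟨mu, ⟨e⟩⟩ := H.complete S hS
  have hm : Mono (e.inv ≫ g ≫ Limits.image.ι f) := inferInstance
  have : mu = lam := eq_of_hom_L_nabla (f := e.inv ≫ g ≫ Limits.image.ι f) (fun h => by
    rw [h] at hm
    exact Simple.not_isZero (H.L mu) (IsZero.of_mono_zero _ (H.nabla lam)))
  subst this
  exact ((isFactor_of_mono g).of_iso e).of_epi (factorThruImage f)

lemma le_of_hom_nabla {lam mu : Λ} {f : H.nabla mu ⟶ H.nabla lam} (hf : f ≠ 0) : lam ≤ mu :=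
  le_of_isFactor_nabla (isFactor_of_hom_nabla hℓ hf)

lemma eq_of_hom_Delta_nabla {lam mu : Λ} {f : H.Delta mu ⟶ H.nabla lam} (hf : f ≠ 0) :
    mu = lam :=
  le_antisymm (le_of_isFactor_nabla (isFactor_of_hom_Delta hf))
    (H.le_of_factor _ _ (isFactor_of_hom_nabla hℓ hf))

/-- `L lam` occurs in `nabla lam` only as its socle. If f kills the socle, it factors through a
cokernel without factor `L lam`, although any nonzero map to `nabla lam` needs one. Otherwise the
kernel of f misses the socle, so f is mono, and length makes it invertible. -/
lemma isIso_of_hom_nabla {lam : Λ} {f : H.nabla lam ⟶ H.nabla lam} (hf : f ≠ 0) : IsIso f := by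
  by_cases h0 : H.incl lam ≫ f = 0
  · exfalso
    have h1 : cokernel.desc (H.incl lam) f h0 ≠ 0 := fun h => hf (by
      rw [← cokernel.π_desc (H.incl lam) f h0, h, comp_zero])
    exact lt_irrefl _ (H.lt_of_factor _ _ (isFactor_of_hom_nabla hℓ h1))
  · have hmono : Mono f := by
      refine Preadditive.mono_of_isZero_kernel f ?_
      by_contra hK
      obtain ⟨S, g, hS, hg⟩ := hℓ.exists_simple_mono hK
      obtain ⟨mu, ⟨e⟩⟩ := H.complete S hS
      have hm : Mono (e.inv ≫ g ≫ kernel.ι f) := inferInstance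
      have hne : e.inv ≫ g ≫ kernel.ι f ≠ 0 := fun h => by
        rw [h] at hm
        exact Simple.not_isZero (H.L mu) (IsZero.of_mono_zero _ (H.nabla lam))
      obtain rfl : mu = lam := eq_of_hom_L_nabla hne
      set s := e.inv ≫ g ≫ kernel.ι f with hs
      have hsf : s ≫ f = 0 := by simp [hs]
      have hs0 : s ≫ cokernel.π (H.incl mu) = 0 := by
        by_contra h
        have : Mono (s ≫ cokernel.π (H.incl mu)) := mono_of_nonzero_from_simple h
        exact lt_irrefl _ (H.lt_of_factor _ _ (isFactor_of_mono (s ≫ cokernel.π (H.incl mu))))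
      have hl : Abelian.monoLift (H.incl mu) s hs0 ≫ H.incl mu = s := Abelian.monoLift_comp _ _ _
      have hl0 : Abelian.monoLift (H.incl mu) s hs0 ≠ 0 := fun h => hne (by
        rw [← hl, h, zero_comp])
      have := isIso_of_hom_simple hl0
      refine h0 ?_
      rw [← cancel_epi (Abelian.monoLift (H.incl mu) s hs0), reassoc_of% hl, hsf, comp_zero]
    exact hℓ.isIso_of_mono f le_rfl

variable [HasExt.{w} C]

lemma ext_eq_zero_of_factors_right {X Y : C} {n : ℕ}
    (h : ∀ lam, IsFactor (H.L lam) Y → ∀ x : Ext X (H.L lam) n, x = 0) :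
    ∀ x : Ext X Y n, x = 0 :=
  devissage (H := H) (P := fun Z => ∀ x : Ext X Z n, x = 0) hℓ
    (fun _ hZ => ext_eq_zero_of_isZero_right hZ) (fun _ hS => ext_eq_zero_mid_right hS)
    (fun _ _ e => ext_eq_zero_of_iso_right e) Y h

lemma ext_eq_zero_of_factors_left {X Y : C} {n : ℕ}
    (h : ∀ lam, IsFactor (H.L lam) X → ∀ x : Ext (H.L lam) Y n, x = 0) :
    ∀ x : Ext X Y n, x = 0 :=
  devissage (H := H) (P := fun Z => ∀ x : Ext Z Y n, x = 0) hℓ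
    (fun _ hZ => ext_eq_zero_of_isZero_left hZ) (fun _ hS => ext_eq_zero_mid_left hS)
    (fun _ _ e => ext_eq_zero_of_iso_left e) X h

omit hℓ in
-- Dimension shifting along the injective envelope: its cokernel by `nabla lam` is filtered by
-- `nabla nu` with lam < nu, so the condition on mu is inherited. In degree one a nonzero map `L mu
-- ⟶ nabla nu` would give mu = nu.
lemma ext_L_nabla_eq_zero (n : ℕ) : ∀ {lam mu : Λ}, ¬ lam < mu →
    ∀ x : Ext (H.L mu) (H.nabla lam) (n + 1), x = 0 := by
  induction n with
  | zero =>
    intro lam mu hlt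
    obtain ⟨I, e, j, hI, -, -, hj, hfil⟩ := H.exists_injective lam
    refine ext_eq_zero_left_end (shortExact_cokernel j) ?_ Ext.eq_zero_of_injective
    refine ext_eq_zero_of_hasFiltration hfil ?_
    rintro Z ⟨nu, hnu, ⟨e⟩⟩
    refine ext_eq_zero_of_iso_right e.symm (ext_zero_eq_zero fun f => ?_)
    by_contra hf
    exact hlt ((eq_of_hom_L_nabla hf) ▸ hnu)
  | succ n ih =>
    intro lam mu hlt
    obtain ⟨I, e, j, hI, -, -, hj, hfil⟩ := H.exists_injective lam
    refine ext_eq_zero_left_end (shortExact_cokernel j) ?_ Ext.eq_zero_of_injective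
    refine ext_eq_zero_of_hasFiltration hfil ?_
    rintro Z ⟨nu, hnu, ⟨e⟩⟩
    exact ext_eq_zero_of_iso_right e.symm (ih fun h => hlt (hnu.trans h))

lemma ext_nabla_eq_zero (n : ℕ) {lam : Λ} {X : C}
    (hX : ∀ mu, IsFactor (H.L mu) X → ¬ lam < mu) : ∀ x : Ext X (H.nabla lam) (n + 1), x = 0 :=
  ext_eq_zero_of_factors_left hℓ fun mu hmu => ext_L_nabla_eq_zero n (hX mu hmu)

lemma ext_Delta_nabla_eq_zero (n : ℕ) : ∀ {lam mu : Λ} (x : Ext (H.Delta lam) (H.nabla mu) (n + 1)),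
    x = 0 := by
  induction n with
  | zero =>
    intro lam mu
    by_cases hlt : mu < lam
    · obtain ⟨I, e, j, hI, -, -, hj, hfil⟩ := H.exists_injective mu
      refine ext_one_eq_zero_of_lifting (shortExact_cokernel j) Ext.eq_zero_of_injective fun f => ?_
      change H.Delta lam ⟶ cokernel j at f
      -- The pullback is an extension of `Delta lam` by `nabla mu` with mu < lam, so its factors are
      -- at most lam; relative projectivity of `Delta lam` splits it.
      obtain ⟨s, hs⟩ := H.lift_Delta lam (pullback (cokernel.π j) f) (H.Delta lam)
        (pullback.snd _ _) (𝟙 _) inferInstance (fun nu hnu => by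
          rcases hnu.of_shortExact (shortExact_kernel (pullback.snd (cokernel.π j) f)) with h | h
          · change IsFactor _ (kernel (pullback.snd (cokernel.π j) f)) at h
            have hz : (kernel.ι (pullback.snd (cokernel.π j) f) ≫ pullback.fst _ _) ≫
                cokernel.π j = 0 := by
              rw [Category.assoc, pullback.condition, kernel.condition_assoc, zero_comp]
            have hm : Mono (kernel.ι (pullback.snd (cokernel.π j) f) ≫ pullback.fst _ _) := by
              refine Preadditive.mono_of_cancel_zero _ fun g hg => ?_
              rw [← cancel_mono (kernel.ι (pullback.snd (cokernel.π j) f)), zero_comp]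
              refine pullback.hom_ext ?_ ?_
              · rw [Category.assoc, hg, zero_comp]
              · simp
            have hl := Abelian.monoLift_comp j _ hz
            have : Mono (Abelian.monoLift j _ hz) := by
              rw [← hl] at hm
              exact mono_of_mono _ j
            exact (le_of_isFactor_nabla (h.of_mono (Abelian.monoLift j _ hz))).trans hlt.le
          · exact H.le_of_factor _ _ h)
      refine ⟨s ≫ pullback.fst _ _, ?_⟩
      change (s ≫ pullback.fst _ _) ≫ cokernel.π j = f
      rw [Category.assoc, pullback.condition, reassoc_of% hs]
    · exact ext_nabla_eq_zero hℓ 0 fun nu hnu h => hlt (h.trans_le (H.le_of_factor _ _ hnu))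
  | succ n ih =>
    intro lam mu
    obtain ⟨I, e, j, hI, -, -, hj, hfil⟩ := H.exists_injective mu
    refine ext_eq_zero_left_end (shortExact_cokernel j) ?_ Ext.eq_zero_of_injective
    refine ext_eq_zero_of_hasFiltration hfil ?_
    rintro Z ⟨nu, hnu, ⟨e⟩⟩
    exact ext_eq_zero_of_iso_right e.symm ih

/-- Dimension shifting along `L nu ⟶ nabla nu`, where `nabla nu` contributes nothing and the
cokernel has only factors below nu. -/
lemma ext_Delta_L_eq_zero (n : ℕ) : ∀ {lam nu : Λ}, ¬ lam < nu →
    ∀ x : Ext (H.Delta lam) (H.L nu) (n + 1), x = 0 := by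
  induction n with
  | zero =>
    intro lam nu hlt
    refine ext_eq_zero_left_end (shortExact_cokernel (H.incl nu)) (ext_zero_eq_zero fun f => ?_)
      (ext_Delta_nabla_eq_zero hℓ 0)
    by_contra hf
    exact hlt (H.lt_of_factor _ _ (isFactor_of_hom_Delta hf))
  | succ n ih =>
    intro lam nu hlt
    refine ext_eq_zero_left_end (shortExact_cokernel (H.incl nu)) ?_
      (ext_Delta_nabla_eq_zero hℓ _)
    exact ext_eq_zero_of_factors_right (H := H) hℓ fun mu hmu =>
      ih fun h => hlt (h.trans (H.lt_of_factor _ _ hmu))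

lemma ext_nabla_nabla_eq_zero (n : ℕ) {lam mu : Λ} (h : ¬ lam < mu) :
    ∀ x : Ext (H.nabla mu) (H.nabla lam) (n + 1), x = 0 :=
  ext_nabla_eq_zero hℓ n fun _ hnu hlt => h (hlt.trans_le (le_of_isFactor_nabla hnu))

lemma ext_Delta_Delta_eq_zero (n : ℕ) {lam mu : Λ} (h : ¬ lam < mu) :
    ∀ x : Ext (H.Delta lam) (H.Delta mu) (n + 1), x = 0 :=
  ext_eq_zero_of_factors_right (H := H) hℓ fun _ hnu => ext_Delta_L_eq_zero hℓ n fun hlt =>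
    h (hlt.trans_le (H.le_of_factor _ _ hnu))

omit hℓ [HasExt.{w} C] in
lemma le_of_hom_Delta {lam mu : Λ} {f : H.Delta lam ⟶ H.Delta mu} (hf : f ≠ 0) : lam ≤ mu :=
  H.le_of_factor _ _ (isFactor_of_hom_Delta hf)

omit hℓ [HasExt.{w} C] in
-- Essentiality of `proj lam` puts the kernel of a nonzero g inside that of `proj lam`; so `proj
-- lam` is g followed by an automorphism of `L lam`, and the kernels agree.
lemma kernel_proj_comp_eq_zero {lam : Λ} (g : H.Delta lam ⟶ H.L lam) :
    kernel.ι (H.proj lam) ≫ g = 0 := by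
  by_cases hg : g = 0
  · rw [hg, comp_zero]
  have hepi : Epi g := epi_of_nonzero_to_simple hg
  have h1 : kernel.ι g ≫ H.proj lam = 0 := by
    by_contra h
    have : Epi (kernel.ι g) := H.essential_proj _ _ _ (epi_of_nonzero_to_simple h)
    exact hg (by rw [← cancel_epi (kernel.ι g), kernel.condition, comp_zero])
  have hc : g ≫ Abelian.epiDesc g (H.proj lam) h1 = H.proj lam := Abelian.comp_epiDesc _ _ _
  have hc0 : Abelian.epiDesc g (H.proj lam) h1 ≠ 0 := fun h => proj_ne_zero (H := H) lam (by
    rw [← hc, h, comp_zero])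
  have := isIso_of_hom_simple hc0
  rw [← cancel_mono (Abelian.epiDesc g (H.proj lam) h1), Category.assoc, hc, kernel.condition,
    zero_comp]

omit hℓ [HasExt.{w} C] in
lemma kernel_proj_comp_nabla_eq_zero {lam : Λ} (g : H.Delta lam ⟶ H.nabla lam) :
    kernel.ι (H.proj lam) ≫ g = 0 := by
  have h0 : g ≫ cokernel.π (H.incl lam) = 0 := by
    by_contra h
    exact lt_irrefl _ (H.lt_of_factor _ _ (isFactor_of_hom_Delta h))
  have hl : Abelian.monoLift (H.incl lam) g h0 ≫ H.incl lam = g := Abelian.monoLift_comp _ _ _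
  rw [← hl, ← Category.assoc, kernel_proj_comp_eq_zero, zero_comp]

omit [HasExt.{w} C] in
-- If a subobject N of the radical mapped onto `L lam`, the composite N ⟶ `nabla lam` would extend
-- to `Delta lam`, because Ext^1 from a quotient of `Delta lam` to `nabla lam` is zero. But every
-- map `Delta lam ⟶ nabla lam` kills the radical.
lemma not_isFactor_kernel_proj (lam : Λ) : ¬ IsFactor (H.L lam) (kernel (H.proj lam)) := by
  have : HasExt.{max u v} C := HasExt.standard C
  rintro ⟨N, i, p, hi, hp⟩
  have hext : ∀ x : Ext.{max u v} (cokernel (i ≫ kernel.ι (H.proj lam))) (H.nabla lam) 1, x = 0 :=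
    ext_nabla_eq_zero hℓ 0 fun mu hmu hlt => lt_irrefl _
      (hlt.trans_le (H.le_of_factor _ _ (hmu.of_epi (cokernel.π _))))
  obtain ⟨g, hg⟩ := exists_extension (shortExact_cokernel (i ≫ kernel.ι (H.proj lam))) hext
    (p ≫ H.incl lam)
  change (i ≫ kernel.ι (H.proj lam)) ≫ g = p ≫ H.incl lam at hg
  rw [Category.assoc, kernel_proj_comp_nabla_eq_zero, comp_zero] at hg
  exact incl_ne_zero (H := H) lam (by rw [← cancel_epi p, ← hg, comp_zero])

omit [HasExt.{w} C] in
lemma lt_of_isFactor_kernel_proj {lam mu : Λ} (h : IsFactor (H.L mu) (kernel (H.proj lam))) :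
    mu < lam :=
  lt_of_le_of_ne (H.le_of_factor _ _ (h.of_mono (kernel.ι _)))
    (fun he => not_isFactor_kernel_proj hℓ lam (he ▸ h))

omit [HasExt.{w} C] in
lemma isIso_of_hom_Delta {lam : Λ} {f : H.Delta lam ⟶ H.Delta lam} (hf : f ≠ 0) : IsIso f := by
  by_cases h0 : f ≫ H.proj lam = 0
  · exfalso
    have h1 : kernel.lift (H.proj lam) f h0 ≠ 0 := fun h => hf (by
      rw [← kernel.lift_ι (H.proj lam) f h0, h, zero_comp])
    exact not_isFactor_kernel_proj hℓ lam (isFactor_of_hom_Delta h1)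
  · have : Epi f := H.essential_proj _ _ _ (epi_of_nonzero_to_simple h0)
    exact hℓ.isIso_of_epi f le_rfl

end Length

end HighestWeight

end AbelianLemmas

/-! ### Morphisms in the derived category and the classes E -/

section Derived

lemma hom_shift_shift_eq_zero {T : Type*} [Category* T] [Preadditive T] [HasShift T ℤ]
    [∀ n : ℤ, (shiftFunctor T n).Additive] {K L : T} {m n p : ℤ} (hp : p + m = n)
    (h : ∀ g : K ⟶ L⟦p⟧, g = 0) (f : K⟦m⟧ ⟶ L⟦n⟧) : f = 0 := by
  let e : L⟦p⟧⟦m⟧ ≅ L⟦n⟧ := (shiftFunctorAdd' T p m n hp).symm.app L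
  obtain ⟨g, hg⟩ := (shiftFunctor T m).map_surjective (f ≫ e.inv)
  rw [← cancel_mono e.inv, ← hg, h g, Functor.map_zero, zero_comp]

variable {C : Type u} [Category.{v} C] [Abelian C] [HasExt.{w} C] [HasDerivedCategory.{w'} C]

open DerivedCategory

omit [HasExt.{w} C] in
lemma hom_single_eq_zero_of_neg {X Y : C} {p : ℤ} (hp : p < 0)
    (f : (singleFunctor C 0).obj X ⟶ ((singleFunctor C 0).obj Y)⟦p⟧) : f = 0 := by
  let e : ((singleFunctor C 0).obj Y)⟦p⟧ ≅ (singleFunctor C (-p)).obj Y :=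
    ((singleFunctors C).shiftIso p (-p) 0 (by omega)).app Y
  rw [← cancel_mono e.hom, zero_comp]
  have : ((singleFunctor C (-p)).obj Y).IsGE 1 :=
    TStructure.t.isGE_of_ge _ 1 (-p) (by omega)
  exact TStructure.t.zero (f ≫ e.hom) 0 1 (by omega)

lemma hom_single_eq_zero {X Y : C} {p : ℤ} (h : ∀ n : ℕ, (n : ℤ) = p → ∀ x : Ext X Y n, x = 0)
    (f : (singleFunctor C 0).obj X ⟶ ((singleFunctor C 0).obj Y)⟦p⟧) : f = 0 := by
  rcases lt_or_ge p 0 with hp | hp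
  · exact hom_single_eq_zero_of_neg hp f
  · obtain ⟨n, rfl⟩ := Int.eq_ofNat_of_zero_le hp
    have h1 : (Ext.homEquiv.symm f : Ext X Y n) = 0 := h n rfl _
    rw [Equiv.symm_apply_eq] at h1
    rw [h1]
    exact Ext.zero_hom _ _ _

lemma exists_ext_ne_zero {X Y : C} {m n : ℤ} {f : shifted X m ⟶ shifted Y n} (hf : f ≠ 0) :
    ∃ p : ℕ, (p : ℤ) + m = n ∧ ∃ x : Ext X Y p, x ≠ 0 := by
  by_contra! h
  exact hf (hom_shift_shift_eq_zero (p := n - m) (by omega)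
    (hom_single_eq_zero fun p hp => h p (by omega)) f)

omit [HasExt.{w} C] in
lemma exists_distTriang_shifted {S : ShortComplex C} (hS : S.ShortExact) (n : ℤ) :
    ∃ (f : shifted S.X₁ n ⟶ shifted S.X₂ n) (g : shifted S.X₂ n ⟶ shifted S.X₃ n)
      (h : shifted S.X₃ n ⟶ (shifted S.X₁ n)⟦(1 : ℤ)⟧),
      Triangle.mk f g h ∈ distTriang (DerivedCategory C) :=
  ⟨_, _, _, Triangle.shift_distinguished _ hS.singleTriangle_distinguished n⟩

/-- The isomorphism `(M[m])[n] ≅ M[p]` for `m + n = p`. -/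
noncomputable def shiftedShiftIso (M : C) (m n p : ℤ) (h : m + n = p) : (shifted M m)⟦n⟧ ≅ shifted M p :=
  (shiftFunctorAdd' (DerivedCategory C) m n p h).symm.app _

/-- The isomorphism `M ≅ M[0]`. -/
noncomputable def shiftedZeroIso (M : C) : (singleFunctor C 0).obj M ≅ shifted M 0 :=
  (shiftFunctorZero (DerivedCategory C) ℤ).symm.app _

lemma exists_ext_ne_zero_of_shift {X Y : C} {m n : ℤ}
    {f : (singleFunctor C 0).obj X ⟶ (shifted Y m)⟦n⟧} (hf : f ≠ 0) :
    ∃ p : ℕ, (p : ℤ) = m + n ∧ ∃ x : Ext X Y p, x ≠ 0 := by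
  let e₁ := shiftedZeroIso X
  let e₂ := shiftedShiftIso Y m n (m + n) rfl
  have hne : e₁.inv ≫ f ≫ e₂.hom ≠ 0 := fun h => hf (by
    rw [← cancel_mono e₂.hom, ← cancel_epi e₁.inv, h, zero_comp, comp_zero])
  obtain ⟨p, hp, hx⟩ := exists_ext_ne_zero hne
  exact ⟨p, by omega, hx⟩

variable {Λ : Type u'}

/-- Morphisms between the shifts of objects of an exceptional family. -/
lemma hom_shifted_trichotomy {V : Λ → C} {r : Λ → Λ → Prop}
    (h0 : ∀ {lam mu : Λ} {f : V mu ⟶ V lam}, f ≠ 0 → IsIso f ∨ r lam mu)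
    (h1 : ∀ (n : ℕ) {lam mu : Λ}, ¬ r lam mu → ∀ x : Ext (V mu) (V lam) (n + 1), x = 0)
    (a b : Λ × ℤ) (f : shifted (V b.1) b.2 ⟶ (shifted (V a.1) a.2)⟦(1 : ℤ)⟧) :
    f = 0 ∨ IsIso f ∨ r a.1 b.1 := by
  by_cases hr : r a.1 b.1
  · exact .inr (.inr hr)
  by_cases hf : f = 0
  · exact .inl hf
  refine .inr (.inl ?_)
  let e := shiftedShiftIso (V a.1) a.2 1 (a.2 + 1) rfl
  have hfe : f ≫ e.hom ≠ 0 := fun h => hf (by rw [← cancel_mono e.hom, h, zero_comp])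
  obtain ⟨p, hp, x, hx⟩ := exists_ext_ne_zero hfe
  -- Positive degrees are excluded by `h1`; so `f` comes from a shifted nonzero morphism of C, which
  -- `h0` makes invertible.
  obtain rfl : p = 0 := by
    cases p with
    | zero => rfl
    | succ p => exact absurd (h1 p hr x) hx
  have hb : b.2 = a.2 + 1 := by simpa using hp
  suffices key : ∀ (n : ℤ) (g : shifted (V b.1) b.2 ⟶ shifted (V a.1) n), b.2 = n → g ≠ 0 →
      IsIso g by
    have := key _ _ hb hfe
    exact IsIso.of_isIso_comp_right f e.hom
  rintro n g rfl hg
  obtain ⟨g', rfl⟩ := (shiftFunctor (DerivedCategory C) b.2).map_surjective g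
  obtain ⟨φ, rfl⟩ := (singleFunctor C 0).map_surjective g'
  have hφ : φ ≠ 0 := by
    rintro rfl
    refine hg ?_
    rw [Functor.map_zero, Functor.map_zero]
    rfl
  have := (h0 hφ).resolve_right hr
  have : IsIso ((singleFunctor C 0).map φ) := Functor.map_isIso _ φ
  exact Functor.map_isIso (shiftFunctor (DerivedCategory C) b.2) ((singleFunctor C 0).map φ)

/-! ### The classes `E` -/

section Classes

variable {V : Λ → C} {l : Λ → ℤ}

omit [HasExt.{w} C] in
lemma E_of_isZero : ∀ (i : ℕ) (X : DerivedCategory C), IsZero X → E V l i X := by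
  intro i
  induction i with
  | zero =>
    intro X hX
    refine ⟨0, Fin.elim0, Fin.elim0, ⟨hX.iso ?_⟩⟩
    exact (IsZero.iff_id_eq_zero _).2 (biproduct.hom_ext _ _ fun j => j.elim0)
  | succ i ih =>
    intro X hX
    exact ⟨X, _, _, _, _, contractible_distinguished X, ih X hX, ih _ (isZero_zero _)⟩

omit [HasExt.{w} C] in
lemma E_mono {i j : ℕ} (hij : i ≤ j) {X : DerivedCategory C} (hX : E V l i X) : E V l j X := by
  induction j, hij using Nat.le_induction with
  | base => exact hX
  | succ j _ ih =>
    exact ⟨X, _, _, _, _, contractible_distinguished X, ih, E_of_isZero j _ (isZero_zero _)⟩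

omit [HasExt.{w} C] in
lemma exists_E_of_distTriang {X₁ X₂ X₃ : DerivedCategory C} {f : X₁ ⟶ X₂} {g : X₂ ⟶ X₃}
    {h : X₃ ⟶ X₁⟦(1 : ℤ)⟧} (hT : Triangle.mk f g h ∈ distTriang (DerivedCategory C))
    (h₁ : ∃ i, E V l i X₁) (h₃ : ∃ i, E V l i X₃) : ∃ i, E V l i X₂ := by
  obtain ⟨i, hi⟩ := h₁
  obtain ⟨j, hj⟩ := h₃
  exact ⟨max i j + 1, X₁, X₃, f, g, h, hT, E_mono (le_max_left i j) hi,
    E_mono (le_max_right i j) hj⟩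

omit [HasExt.{w} C] in
lemma exists_E_shifted {lam : Λ} {m : ℤ} (hm : m ≡ l lam [ZMOD 2]) :
    ∃ i, E V l i (shifted (V lam) m) := by
  obtain ⟨c, hc⟩ := Int.modEq_iff_dvd.1 hm.symm
  obtain rfl : m = l lam + 2 * c := by omega
  exact ⟨0, 1, fun _ => lam, fun _ => c,
    ⟨(biproductUniqueIso fun _ : Fin 1 => shifted (V lam) (l lam + 2 * c)).symm⟩⟩

end Classes

/-! ### Recognition of Kazhdan-Lusztig theories -/

namespace HighestWeight

variable [PartialOrder Λ] [Finite Λ] {H : HighestWeight C Λ} {ℓ : C → ℕ}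
  (hℓ : IsLengthFunction ℓ)
include hℓ

omit [HasExt.{w} C] [Finite Λ] in
lemma exists_word_of_factors {V : Λ → C} {X : C}
    (h : ∀ lam, IsFactor (H.L lam) X → ∀ n : ℤ, ∃ w : List (Λ × ℤ),
      Word (fun a : Λ × ℤ => shifted (V a.1) a.2) w (shifted (H.L lam) n)) (n : ℤ) :
    ∃ w : List (Λ × ℤ), Word (fun a : Λ × ℤ => shifted (V a.1) a.2) w (shifted X n) := by
  revert n
  refine devissage (H := H) (P := fun Z => ∀ n : ℤ, ∃ w : List (Λ × ℤ),
      Word (fun a : Λ × ℤ => shifted (V a.1) a.2) w (shifted Z n)) hℓ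
      (fun Z hZ n => ⟨[], .nil _ ?_⟩) (fun S hS h₁ h₃ n => ?_) (fun Y Z e hY n => ?_) X h
  · exact (shiftFunctor (DerivedCategory C) n).map_isZero ((singleFunctor C 0).map_isZero hZ)
  · obtain ⟨f, g, h, hT⟩ := exists_distTriang_shifted hS n
    obtain ⟨w₁, hw₁⟩ := h₁ n
    obtain ⟨w₃, hw₃⟩ := h₃ n
    exact ⟨_, Word.append hT hw₃ hw₁⟩
  · obtain ⟨w, hw⟩ := hY n
    exact ⟨w, hw.of_iso ((shiftFunctor (DerivedCategory C) n).mapIso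
      ((singleFunctor C 0).mapIso e))⟩

omit [HasExt.{w} C] in
-- Rotating the triangle of `incl lam` makes L(λ)[n] an extension of ∇(λ)[n] by the cokernel in
-- shift n - 1, whose factors have smaller weight.
lemma exists_word_nabla (lam : Λ) : ∀ n : ℤ, ∃ w : List (Λ × ℤ),
    Word (fun a : Λ × ℤ => shifted (H.nabla a.1) a.2) w (shifted (H.L lam) n) := by
  induction lam using (Finite.to_wellFoundedLT (α := Λ)).wf.induction with
  | _ lam ih =>
  intro n
  obtain ⟨w, hw⟩ := exists_word_of_factors hℓ (X := cokernel (H.incl lam))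
    (fun mu hmu => ih mu (H.lt_of_factor _ _ hmu)) (n - 1)
  obtain ⟨f, g, h, hT⟩ := exists_distTriang_shifted (shortExact_cokernel (H.incl lam)) n
  exact ⟨(lam, n) :: w, .cons (lam, n) w _ _ _ _ _ (inv_rot_of_distTriang _ hT)
    (hw.of_iso (shiftedShiftIso (cokernel (H.incl lam)) n (-1) (n - 1) (by omega)).symm)⟩

omit [HasExt.{w} C] in
-- Here the kernel of `proj lam`, in shift n + 1, is the quotient and Δ(λ)[n] the bottom letter.
lemma exists_word_Delta (lam : Λ) : ∀ n : ℤ, ∃ w : List (Λ × ℤ),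
    Word (fun a : Λ × ℤ => shifted (H.Delta a.1) a.2) w (shifted (H.L lam) n) := by
  induction lam using (Finite.to_wellFoundedLT (α := Λ)).wf.induction with
  | _ lam ih =>
  intro n
  obtain ⟨w, hw⟩ := exists_word_of_factors hℓ (X := kernel (H.proj lam))
    (fun mu hmu => ih mu (lt_of_isFactor_kernel_proj hℓ hmu)) (n + 1)
  obtain ⟨f, g, h, hT⟩ := exists_distTriang_shifted (shortExact_kernel (H.proj lam)) n
  exact ⟨_, Word.append (O := fun a : Λ × ℤ => shifted (H.Delta a.1) a.2)
    (rot_of_distTriang _ hT)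
    (hw.of_iso (shiftedShiftIso (kernel (H.proj lam)) n 1 (n + 1) rfl).symm)
    (word_singleton (O := fun a : Λ × ℤ => shifted (H.Delta a.1) a.2) (lam, n))⟩

omit [HasDerivedCategory.{w'} C] [Finite Λ] in
lemma eq_of_ext_Delta_nabla {lam mu : Λ} {n : ℕ} {x : Ext (H.Delta mu) (H.nabla lam) n}
    (hx : x ≠ 0) : mu = lam ∧ n = 0 := by
  cases n with
  | zero =>
    refine ⟨?_, rfl⟩
    by_contra h
    refine hx (ext_zero_eq_zero (fun f => ?_) x)
    by_contra hf
    exact h (eq_of_hom_Delta_nabla hℓ hf)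
  | succ n => exact absurd (ext_Delta_nabla_eq_zero hℓ n x) hx

omit hℓ [HasExt.{w} C] [HasDerivedCategory.{w'} C] [Finite Λ] in
lemma proj_comp_incl_ne_zero (lam : Λ) : H.proj lam ≫ H.incl lam ≠ 0 := fun h =>
  proj_ne_zero (H := H) lam (by rw [← cancel_mono (H.incl lam), h, zero_comp])

/-- If the groups `Ext^n(Delta mu, L lam)` and `Ext^n(L lam, nabla mu)` vanish for all `n` of the
wrong parity, there is a Kazhdan-Lusztig theory. -/
theorem hasKLTheory_of_parity {l : Λ → ℤ}
    (hDelta : ∀ (mu lam : Λ) (p : ℕ) (x : Ext (H.Delta mu) (H.L lam) p), x ≠ 0 →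
      (p : ℤ) + l lam ≡ l mu [ZMOD 2])
    (hnabla : ∀ (mu lam : Λ) (p : ℕ) (x : Ext (H.L lam) (H.nabla mu) p), x ≠ 0 →
      (p : ℤ) + l lam ≡ l mu [ZMOD 2]) : HasKLTheory H l := by
  intro lam
  constructor
  · obtain ⟨w, hw⟩ := exists_word_nabla (H := H) hℓ lam (l lam)
    -- Positive Ext groups between costandard objects go from larger to smaller weights, so the top
    -- letter has maximal weight.
    refine Word.recognition_right (V := fun mu => (singleFunctor C 0).obj (H.nabla mu))
      (D := fun mu => (singleFunctor C 0).obj (H.Delta mu)) (l := l)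
      (r := fun x y => x < y) (G := ER H l) ?_ ?_ ?_ ?_ ?_ ?_ w.length w _ rfl hw ?_
    · refine hom_shifted_trichotomy (V := H.nabla) (r := fun x y => x < y) ?_
        (fun n _ _ h => ext_nabla_nabla_eq_zero hℓ n h)
      intro x y f hf
      rcases (le_of_hom_nabla hℓ hf).lt_or_eq with h | rfl
      · exact .inr h
      · exact .inl (isIso_of_hom_nabla hℓ hf)
    · intro mu nu m n f hf
      obtain ⟨p, hp, x, hx⟩ :=
        exists_ext_ne_zero_of_shift (X := H.Delta mu) (Y := H.nabla nu) (m := m) hf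
      obtain ⟨h1, rfl⟩ := eq_of_ext_Delta_nabla hℓ hx
      exact ⟨h1, by simp at hp; omega⟩
    · intro mu m
      let e := (shiftFunctorCompIsoId (DerivedCategory C) m (-m) (by omega)).symm.app
        ((singleFunctor C 0).obj (H.nabla mu))
      refine ⟨(singleFunctor C 0).map (H.proj mu ≫ H.incl mu) ≫ e.hom, fun h => ?_⟩
      rw [← zero_comp (f := e.hom), cancel_mono] at h
      exact proj_comp_incl_ne_zero mu ((singleFunctor C 0).map_injective (by simpa using h))
    · exact fun X hX => ⟨0, E_of_isZero 0 X hX⟩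
    · exact fun mu m hm => exists_E_shifted (V := H.nabla) hm
    · exact fun _ _ _ _ _ _ hT h₁ h₃ => exists_E_of_distTriang hT h₁ h₃
    · intro mu n f hf
      obtain ⟨p, hp, x, hx⟩ := exists_ext_ne_zero_of_shift (X := H.Delta mu) hf
      have h2 := hDelta mu lam p x hx
      have h3 : n ≡ p + l lam [ZMOD 2] := Int.modEq_iff_dvd.2 ⟨l lam, by omega⟩
      exact h3.trans h2
  · obtain ⟨w, hw⟩ := exists_word_Delta (H := H) hℓ lam (l lam)
    -- For standard objects positive Ext groups go from smaller to larger weights, so the order is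
    -- reversed and the top letter has minimal weight.
    refine Word.recognition_left (V := fun mu => (singleFunctor C 0).obj (H.Delta mu))
      (D := fun mu => (singleFunctor C 0).obj (H.nabla mu)) (l := l)
      (r := fun x y => y < x) (G := EL H l) ?_ ?_ ?_ ?_ ?_ ?_ w.length w _ rfl hw ?_
    · refine hom_shifted_trichotomy (V := H.Delta) (r := fun x y => y < x) ?_
        (fun n _ _ h => ext_Delta_Delta_eq_zero hℓ n h)
      intro x y f hf
      rcases (le_of_hom_Delta hf).lt_or_eq with h | rfl
      · exact .inr h
      · exact .inl (isIso_of_hom_Delta hℓ hf)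
    · intro mu nu m n f hf
      obtain ⟨p, hp, x, hx⟩ := exists_ext_ne_zero (X := H.Delta nu) (Y := H.nabla mu) hf
      obtain ⟨h1, rfl⟩ := eq_of_ext_Delta_nabla hℓ hx
      exact ⟨h1.symm, by simp at hp; omega⟩
    · intro mu m
      refine ⟨((singleFunctor C 0).map (H.proj mu ≫ H.incl mu))⟦m⟧', fun h => ?_⟩
      rw [Functor.map_eq_zero_iff] at h
      exact proj_comp_incl_ne_zero (H := H) mu ((singleFunctor C 0).map_injective (by simpa using h))
    · exact fun X hX => ⟨0, E_of_isZero 0 X hX⟩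
    · exact fun mu m hm => exists_E_shifted (V := H.Delta) hm
    · exact fun _ _ _ _ _ _ hT h₁ h₃ => exists_E_of_distTriang hT h₁ h₃
    · intro mu n f hf
      obtain ⟨p, hp, x, hx⟩ := exists_ext_ne_zero (X := H.L lam) (Y := H.nabla mu) hf
      rw [← hp]
      exact hnabla mu lam p x hx

end HighestWeight

end Derived

/-! ### Finitely generated modules as objects of an abelian category -/

section ModuleBridge

variable {A : Type u} [Ring A]

/-- The morphism of `FGModuleCat A` given by a linear map. -/
def homOf {X Y : FGModuleCat.{u} A} (f : X →ₗ[A] Y) : X ⟶ Y :=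
  ObjectProperty.homMk (ModuleCat.ofHom f)

/-- The linear map underlying a morphism of `FGModuleCat A`. -/
abbrev linOf {X Y : FGModuleCat.{u} A} (f : X ⟶ Y) : X →ₗ[A] Y := f.hom.hom

lemma linOf_injective {X Y : FGModuleCat.{u} A} {f g : X ⟶ Y} (h : linOf f = linOf g) : f = g :=
  FGModuleCat.hom_ext h

lemma jacobson_le_ker_of_simple {V W : Type*} [AddCommGroup V] [Module A V] [AddCommGroup W]
    [Module A W] [IsSimpleModule A W] (f : V →ₗ[A] W) : Module.jacobson A V ≤ LinearMap.ker f := by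
  have := Module.le_comap_jacobson f
  have hb : Module.jacobson A W = ⊥ := IsSemisimpleModule.jacobson_eq_bot A W
  rwa [hb] at this

variable [IsNoetherianRing A]

lemma mono_iff_injective {X Y : FGModuleCat.{u} A} (f : X ⟶ Y) :
    Mono f ↔ Function.Injective (linOf f) := by
  rw [← (forget₂ (FGModuleCat.{u} A) (ModuleCat.{u} A)).mono_map_iff_mono,
    ModuleCat.mono_iff_injective]
  rfl

lemma epi_iff_surjective {X Y : FGModuleCat.{u} A} (f : X ⟶ Y) :
    Epi f ↔ Function.Surjective (linOf f) := by
  rw [← (forget₂ (FGModuleCat.{u} A) (ModuleCat.{u} A)).epi_map_iff_epi,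
    ModuleCat.epi_iff_surjective]
  rfl

lemma exact_of_shortExact {S : ShortComplex (FGModuleCat.{u} A)} (hS : S.ShortExact) :
    Function.Exact (linOf S.f) (linOf S.g) := by
  have h := hS.map_of_exact (forget₂ (FGModuleCat.{u} A) (ModuleCat.{u} A))
  exact (ShortComplex.ShortExact.moduleCat_exact_iff_function_exact _).1 h.exact

lemma shortExact_of_exact {X Y Z : FGModuleCat.{u} A} (f : X ⟶ Y) (g : Y ⟶ Z)
    (hf : Function.Injective (linOf f)) (hg : Function.Surjective (linOf g))
    (h : Function.Exact (linOf f) (linOf g)) :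
    (ShortComplex.mk f g (linOf_injective (LinearMap.ext fun x => h.apply_apply_eq_zero x))).ShortExact := by
  have : Mono f := (mono_iff_injective f).2 hf
  have : Epi g := (epi_iff_surjective g).2 hg
  refine ShortComplex.ShortExact.mk ?_
  rw [← ShortComplex.exact_map_iff_of_faithful _ (forget₂ (FGModuleCat.{u} A) (ModuleCat.{u} A))]
  exact (ShortComplex.ShortExact.moduleCat_exact_iff_function_exact _).2 h

lemma isLengthFunction_length [IsArtinianRing A] :
    IsLengthFunction (fun X : FGModuleCat.{u} A => (Module.length A X).toNat) where
  add S hS := by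
    have := Module.length_eq_add_of_exact (linOf S.f) (linOf S.g)
      ((mono_iff_injective _).1 hS.mono_f) ((epi_iff_surjective _).1 hS.epi_g)
      (exact_of_shortExact hS)
    simp only [this]
    exact ENat.toNat_add Module.length_ne_top Module.length_ne_top
  isZero X hX := by
    have h : Module.length A X = 0 := by
      rcases ENat.toNat_eq_zero.1 hX with h | h
      · exact h
      · exact absurd h Module.length_ne_top
    have := Module.length_eq_zero_iff.1 h
    rw [IsZero.iff_id_eq_zero]
    exact linOf_injective (LinearMap.ext fun x => Subsingleton.elim _ _)

lemma isSimpleModule_of_simple (X : FGModuleCat.{u} A) [Simple X] : IsSimpleModule A X := by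
  have hn : Nontrivial X := by
    by_contra h
    rw [not_nontrivial_iff_subsingleton] at h
    exact Simple.not_isZero X ((IsZero.iff_id_eq_zero X).2
      (linOf_injective (LinearMap.ext fun x => Subsingleton.elim _ _)))
  have : IsSimpleOrder (Submodule A X) :=
    { toNontrivial := (Submodule.nontrivial_iff A).2 hn
      eq_bot_or_eq_top := fun N => by
        let i : FGModuleCat.of A N ⟶ X := homOf N.subtype
        have : Mono i := (mono_iff_injective i).2 N.injective_subtype
        by_cases hi : i = 0
        · left
          rw [eq_bot_iff]
          intro x hx
          exact congrArg (fun f : FGModuleCat.of A N ⟶ X => linOf f (⟨x, hx⟩ : N)) hi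
        · right
          have : IsIso i := isIso_of_mono_of_nonzero hi
          have hs : Function.Surjective N.subtype := (epi_iff_surjective i).1 inferInstance
          rw [← Submodule.range_subtype N]
          exact LinearMap.range_eq_top.2 hs }
  exact { toIsSimpleOrder := this }

lemma simple_of_isSimpleModule (X : FGModuleCat.{u} A) [IsSimpleModule A X] : Simple X where
  mono_isIso_iff_nonzero {Y} f hf := by
    constructor
    · intro hi h0
      have hs : Function.Surjective (linOf f) := (epi_iff_surjective f).1 inferInstance
      have := IsSimpleModule.nontrivial A X
      obtain ⟨x, hx⟩ := exists_ne (0 : X)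
      obtain ⟨y, rfl⟩ := hs x
      exact hx (by rw [h0]; rfl)
    · intro h0
      have : linOf f ≠ 0 := fun h => h0 (linOf_injective h)
      have : Epi f := (epi_iff_surjective f).2 (LinearMap.surjective_of_ne_zero this)
      exact isIso_of_mono_of_epi f

lemma shortExact_submodule (X : FGModuleCat.{u} A) (N : Submodule A X) :
    (ShortComplex.mk (homOf N.subtype : FGModuleCat.of A N ⟶ X)
      (homOf N.mkQ : X ⟶ FGModuleCat.of A (X ⧸ N)) (linOf_injective (LinearMap.ext fun x =>
        (LinearMap.exact_subtype_mkQ N).apply_apply_eq_zero x))).ShortExact :=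
  shortExact_of_exact (homOf N.subtype : FGModuleCat.of A N ⟶ X)
    (homOf N.mkQ : X ⟶ FGModuleCat.of A (X ⧸ N)) N.injective_subtype N.mkQ_surjective
    (LinearMap.exact_subtype_mkQ N)

section

variable [HasExt.{w} (FGModuleCat.{u} A)]

lemma exists_linear_extension {X Y : FGModuleCat.{u} A} (N : Submodule A X)
    (h : ∀ x : Ext (FGModuleCat.of A (X ⧸ N)) Y 1, x = 0) (f : N →ₗ[A] Y) :
    ∃ g : X →ₗ[A] Y, ∀ (x : X) (hx : x ∈ N), g x = f ⟨x, hx⟩ := by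
  obtain ⟨g, hg⟩ := exists_extension (shortExact_submodule X N) h (homOf f)
  exact ⟨linOf g, fun x hx => congrArg (fun q : FGModuleCat.of A N ⟶ Y => linOf q (⟨x, hx⟩ : N)) hg⟩

lemma exists_linear_lifting {X Y : FGModuleCat.{u} A} (N : Submodule A X)
    (h : ∀ x : Ext Y (FGModuleCat.of A N) 1, x = 0) (f : Y →ₗ[A] X ⧸ N) :
    ∃ g : Y →ₗ[A] X, ∀ y, N.mkQ (g y) = f y := by
  obtain ⟨g, hg⟩ := exists_lifting (shortExact_submodule X N) h (homOf f)
  exact ⟨linOf g, fun y => congrArg (fun q => linOf q y) hg⟩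

end

section

variable {Λ : Type u'} [PartialOrder Λ] (H : HighestWeight (FGModuleCat.{u} A) Λ)

instance HighestWeight.isSimpleModule_L (lam : Λ) : IsSimpleModule A (H.L lam) :=
  isSimpleModule_of_simple _

lemma HighestWeight.exists_linearEquiv_L (V : Type u) [AddCommGroup V] [Module A V]
    [IsSimpleModule A V] : ∃ lam, Nonempty (V ≃ₗ[A] H.L lam) := by
  have := simple_of_isSimpleModule (FGModuleCat.of A V)
  obtain ⟨lam, ⟨e⟩⟩ := H.complete (FGModuleCat.of A V) this
  exact ⟨lam, ⟨FGModuleCat.isoToLinearEquiv e⟩⟩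

/-- The radical of a semisimple module is zero, so some maximal submodule misses q. -/
lemma HighestWeight.exists_linear_apply_ne_zero {V : Type u} [AddCommGroup V] [Module A V]
    [IsSemisimpleModule A V] {q : V} (hq : q ≠ 0) :
    ∃ (lam : Λ) (f : V →ₗ[A] H.L lam), f q ≠ 0 := by
  have hb : Module.jacobson A V = ⊥ := IsSemisimpleModule.jacobson_eq_bot A V
  have : q ∉ Module.jacobson A V := by rwa [hb, Submodule.mem_bot]
  rw [Module.jacobson, Submodule.mem_sInf] at this
  push Not at this
  obtain ⟨m, hm, hqm⟩ := this
  have := isSimpleModule_iff_isCoatom.2 hm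
  obtain ⟨lam, ⟨e⟩⟩ := H.exists_linearEquiv_L (V ⧸ m)
  refine ⟨lam, e.toLinearMap.comp m.mkQ, fun h => hqm ?_⟩
  simpa using h

variable {H}

lemma exists_linear_of_isFactor {V : FGModuleCat.{u} A} [IsSemisimpleModule A V] {lam : Λ}
    (h : IsFactor (H.L lam) V) : ∃ f : V →ₗ[A] H.L lam, f ≠ 0 := by
  obtain ⟨N, i, p, hi, hp⟩ := h
  obtain ⟨f, hf⟩ := IsSemisimpleModule.extension_property (linOf i) ((mono_iff_injective i).1 hi)
    (linOf p)
  refine ⟨f, fun h0 => ?_⟩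
  have := (epi_iff_surjective p).1 hp
  rw [← hf, h0, LinearMap.zero_comp] at this
  have hn := IsSimpleModule.nontrivial A (H.L lam)
  obtain ⟨x, hx⟩ := exists_ne (0 : H.L lam)
  obtain ⟨y, hy⟩ := this x
  exact hx hy.symm

lemma exists_linear_from_of_isFactor {V : FGModuleCat.{u} A} [IsSemisimpleModule A V] {lam : Λ}
    (h : IsFactor (H.L lam) V) : ∃ f : H.L lam →ₗ[A] V, f ≠ 0 := by
  obtain ⟨N, i, p, hi, hp⟩ := h
  have hi := (mono_iff_injective i).1 hi
  have : IsSemisimpleModule A N := IsSemisimpleModule.of_injective (linOf i) hi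
  obtain ⟨f, hf⟩ := IsSemisimpleModule.lifting_property (linOf p) ((epi_iff_surjective p).1 hp)
    LinearMap.id
  refine ⟨(linOf i).comp f, fun h0 => ?_⟩
  have hn := IsSimpleModule.nontrivial A (H.L lam)
  obtain ⟨x, hx⟩ := exists_ne (0 : H.L lam)
  have h1 : f x = 0 := hi (by simpa using LinearMap.congr_fun h0 x)
  have h2 : linOf p (f x) = x := LinearMap.congr_fun hf x
  rw [h1, map_zero] at h2
  exact hx h2.symm

variable [HasExt.{w} (FGModuleCat.{u} A)] [IsArtinianRing A]

/-- The factors of a semisimple module are among its irreducible quotients, so only these enter the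
dévissage. -/
lemma ext_eq_zero_of_semisimple_left {X Y : FGModuleCat.{u} A} [IsSemisimpleModule A X] {n : ℕ}
    (h : ∀ (lam : Λ) (f : X →ₗ[A] H.L lam), f ≠ 0 → ∀ x : Ext (H.L lam) Y n, x = 0)
    (x : Ext X Y n) : x = 0 :=
  HighestWeight.ext_eq_zero_of_factors_left (H := H) isLengthFunction_length
    (fun lam hlam => by
      obtain ⟨f, hf⟩ := exists_linear_of_isFactor hlam
      exact h lam f hf) x

lemma ext_eq_zero_of_semisimple_right {X Y : FGModuleCat.{u} A} [IsSemisimpleModule A Y] {n : ℕ}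
    (h : ∀ (lam : Λ) (f : H.L lam →ₗ[A] Y), f ≠ 0 → ∀ x : Ext X (H.L lam) n, x = 0)
    (x : Ext X Y n) : x = 0 :=
  HighestWeight.ext_eq_zero_of_factors_right (H := H) isLengthFunction_length
    (fun lam hlam => by
      obtain ⟨f, hf⟩ := exists_linear_from_of_isFactor hlam
      exact h lam f hf) x

end

end ModuleBridge

/-! ### Graded modules and their filtration by grade -/

section GradedBridge

variable {k : Type u'} [Field k] {A : Type u} [Ring A] [Algebra k A] {𝒜 : ℕ → Submodule k A}

namespace GrMod

variable (M : GrMod 𝒜)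

/-- The projection onto the component of grade `j`. -/
noncomputable def proj (j : ℤ) : M.obj →+ M.obj where
  toFun x := by
    let _ := M.isInternal.chooseDecomposition
    exact (DirectSum.decompose M.comp x j : M.obj)
  map_zero' := by simp
  map_add' x y := by simp

lemma proj_mem (j : ℤ) (x : M.obj) : M.proj j x ∈ M.comp j := SetLike.coe_mem _

lemma proj_of_mem {j : ℤ} {x : M.obj} (hx : x ∈ M.comp j) : M.proj j x = x := by
  let _ := M.isInternal.chooseDecomposition
  exact DirectSum.decompose_of_mem_same M.comp hx

lemma proj_of_mem_ne {i j : ℤ} {x : M.obj} (hx : x ∈ M.comp i) (h : i ≠ j) : M.proj j x = 0 := by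
  let _ := M.isInternal.chooseDecomposition
  exact DirectSum.decompose_of_mem_ne M.comp hx h

lemma exists_eq_sum_proj (x : M.obj) : ∃ s : Finset ℤ, ∑ j ∈ s, M.proj j x = x := by
  classical
  let _ := M.isInternal.chooseDecomposition
  exact ⟨_, DirectSum.sum_support_decompose M.comp x⟩

lemma induction_homogeneous {p : M.obj → Prop} (h0 : p 0) (hadd : ∀ x y, p x → p y → p (x + y))
    (x : M.obj) (h : ∀ j, p (M.proj j x)) : p x := by
  obtain ⟨s, hs⟩ := M.exists_eq_sum_proj x
  rw [← hs]
  exact Finset.sum_induction _ p hadd h0 fun j _ => h j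

lemma proj_smul {i : ℕ} {a : A} (ha : a ∈ 𝒜 i) (j : ℤ) (x : M.obj) :
    M.proj (i + j) (a • x) = a • M.proj j x := by
  induction x using M.induction_homogeneous with
  | h0 => simp
  | hadd x y hx hy => rw [smul_add, map_add, map_add, smul_add, hx, hy]
  | h n =>
    have hn := M.proj_mem n x
    by_cases h : n = j
    · subst h
      rw [M.proj_of_mem (M.smul_mem i n a _ ha hn), M.proj_of_mem hn]
    · rw [M.proj_of_mem_ne hn h, M.proj_of_mem_ne (M.smul_mem i n a _ ha hn) (by lia), smul_zero]

lemma proj_map {M N : GrMod 𝒜} {f : M.obj ⟶ N.obj} (hf : PreservesGrade M N f) (j : ℤ)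
    (x : M.obj) : N.proj j (linOf f x) = linOf f (M.proj j x) := by
  induction x using M.induction_homogeneous with
  | h0 => simp
  | hadd x y hx hy => rw [map_add, map_add, map_add, map_add, hx, hy]
  | h n =>
    have hn := M.proj_mem n x
    have hfn : linOf f (M.proj n x) ∈ N.comp n := hf n _ hn
    by_cases h : n = j
    · subst h
      rw [N.proj_of_mem hfn, M.proj_of_mem hn]
    · rw [M.proj_of_mem_ne hn h, N.proj_of_mem_ne hfn h, map_zero]

/-- Nakayama's argument: a maximal submodule containing the component of grade n contains the other
components too, since they lie in the radical. -/
lemma span_comp_eq_top {M : GrMod 𝒜} {n : ℤ}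
    (h : HeadInGrade M n) : Submodule.span A (M.comp n : Set M.obj) = ⊤ := by
  by_contra hT
  obtain ⟨m, hm, hle⟩ := (eq_top_or_exists_le_coatom
    (Submodule.span A (M.comp n : Set M.obj))).resolve_left hT
  refine hm.1 (top_le_iff.1 fun x _ => ?_)
  refine M.induction_homogeneous m.zero_mem (fun _ _ => m.add_mem) x fun j => ?_
  by_cases hj : j = n
  · subst hj
    exact hle (Submodule.subset_span (M.proj_mem j x))
  · exact (Submodule.mem_sInf.1 (h j _ hj (M.proj_mem j x))) m hm

variable [GradedAlgebra 𝒜]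

/-- The submodule of the elements all of whose components of grade less than `d` vanish. -/
noncomputable def ge (d : ℤ) : Submodule A M.obj where
  carrier := {x | ∀ j, j < d → M.proj j x = 0}
  add_mem' hx hy j hj := by rw [map_add, hx j hj, hy j hj, add_zero]
  zero_mem' j _ := map_zero _
  smul_mem' a x hx := by
    induction a using DirectSum.Decomposition.inductionOn 𝒜 with
    | zero => intro j _; rw [zero_smul, map_zero]
    | @homogeneous i a =>
      intro j hj
      have := M.proj_smul a.2 (j - i) x
      rw [add_sub_cancel, hx _ (by lia), smul_zero] at this
      exact this
    | add a b ha hb =>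
      intro j hj
      rw [add_smul, map_add, ha j hj, hb j hj, add_zero]

variable {M}

lemma mem_ge_of_mem_comp {d j : ℤ} {x : M.obj} (hx : x ∈ M.comp j) (h : d ≤ j) : x ∈ M.ge d :=
  fun _ hi => M.proj_of_mem_ne hx (by lia)

lemma ge_anti {d e : ℤ} (h : d ≤ e) : M.ge e ≤ M.ge d := fun _ hx j hj => hx j (by lia)

lemma smul_mem_ge {d : ℤ} {i : ℕ} {a : A} (ha : a ∈ 𝒜 i) {x : M.obj} (hx : x ∈ M.ge d) :
    a • x ∈ M.ge (d + i) := by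
  intro j hj
  have := M.proj_smul ha (j - i) x
  rwa [add_sub_cancel, hx _ (by lia), smul_zero] at this

lemma smul_mem_ge_succ {d : ℤ} {i : ℕ} (hi : 0 < i) {a : A} (ha : a ∈ 𝒜 i) {x : M.obj}
    (hx : x ∈ M.ge d) : a • x ∈ M.ge (d + 1) :=
  ge_anti (by lia) (smul_mem_ge ha hx)

lemma ge_le {d : ℤ} {N : Submodule A M.obj} (h : ∀ j, d ≤ j → ∀ x ∈ M.comp j, x ∈ N) :
    M.ge d ≤ N := by
  intro x hx
  refine M.induction_homogeneous N.zero_mem (fun _ _ => N.add_mem) x fun j => ?_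
  rcases lt_or_ge j d with hj | hj
  · rw [hx j hj]
    exact N.zero_mem
  · exact h j hj _ (M.proj_mem j x)

lemma map_mem_ge {M N : GrMod 𝒜} {f : M.obj ⟶ N.obj} (hf : PreservesGrade M N f) {d : ℤ}
    {x : M.obj} (hx : x ∈ M.ge d) : linOf f x ∈ N.ge d := by
  intro j hj
  rw [proj_map hf, hx j hj, map_zero]

lemma sub_proj_mem_ge {d : ℤ} {x : M.obj} (hx : x ∈ M.ge d) : x - M.proj d x ∈ M.ge (d + 1) := by
  intro j hj
  rw [map_sub]
  rcases (by lia : j < d ∨ j = d) with h | rfl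
  · rw [hx j h, M.proj_of_mem_ne (M.proj_mem d x) (by lia), sub_zero]
  · rw [M.proj_of_mem (M.proj_mem j x), sub_self]

lemma ge_eq_top {n : ℤ} (h : HeadInGrade M n) : M.ge n = ⊤ := by
  rw [← top_le_iff, ← span_comp_eq_top h, Submodule.span_le]
  exact fun x hx => mem_ge_of_mem_comp hx le_rfl

lemma ge_succ_le_jacobson {n : ℤ} (h : HeadInGrade M n) : M.ge (n + 1) ≤ Module.jacobson A M.obj :=
  ge_le fun j hj x hx => h j x (by lia) hx

/-- A simple submodule of `M.ge (s + 1)` would lie in the socle, hence in grade s, where `M.ge (s +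
1)` has nothing. -/
lemma ge_succ_eq_bot [IsArtinianRing A] {s : ℤ} (h : SocleInGrade M s) : M.ge (s + 1) = ⊥ := by
  by_contra hT
  obtain ⟨S, hS, hle⟩ := (eq_bot_or_exists_atom_le (M.ge (s + 1))).resolve_left hT
  refine hS.1 (eq_bot_iff.2 fun x hx => ?_)
  have h1 : x ∈ M.comp s :=
    h x (le_sSup (show S ∈ {S : Submodule A M.obj | IsSimpleModule A S} from isSimpleModule_iff_isAtom.2 hS) hx)
  have h2 := hle hx s (by lia)
  rwa [M.proj_of_mem h1] at h2

end GrMod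

section Semisimple

variable [GradedAlgebra 𝒜]

lemma smul_eq_decompose_zero_smul {V : Type*} [AddCommGroup V] [Module A V]
    (h : ∀ i, 0 < i → ∀ a ∈ 𝒜 i, ∀ x : V, a • x = 0) (a : A) (x : V) :
    a • x = (DirectSum.decompose 𝒜 a 0 : A) • x := by
  induction a using DirectSum.Decomposition.inductionOn 𝒜 with
  | zero => simp
  | @homogeneous i a =>
    rcases Nat.eq_zero_or_pos i with rfl | hi
    · rw [DirectSum.decompose_of_mem_same 𝒜 a.2]
    · rw [DirectSum.decompose_of_mem_ne 𝒜 a.2 hi.ne', h i hi a a.2, zero_smul]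
  | add a b ha hb =>
    rw [add_smul, ha, hb, DirectSum.decompose_add, DirectSum.add_apply, Submodule.coe_add, add_smul]

/-- A module killed by all homogeneous elements of positive degree is semisimple. -/
lemma isSemisimpleModule_of_smul_eq_zero (hA₀ : IsSemisimpleRing (𝒜 0)) {V : Type*}
    [AddCommGroup V] [Module A V] (h : ∀ i, 0 < i → ∀ a ∈ 𝒜 i, ∀ x : V, a • x = 0) :
    IsSemisimpleModule A V := by
  -- A acts through its projection onto the semisimple ring A_0, so the identity of V is semilinear
  -- over that projection and carries semisimplicity over.
  let _ : Module (𝒜 0) V := Module.compHom V (SetLike.GradeZero.subring 𝒜).subtype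
  have : RingHomSurjective (GradedRing.projZeroRingHom' 𝒜) :=
    ⟨GradedRing.projZeroRingHom'_surjective 𝒜⟩
  let f : V →ₛₗ[GradedRing.projZeroRingHom' 𝒜] V :=
    { toFun := id
      map_add' := fun _ _ => rfl
      map_smul' := fun a x => smul_eq_decompose_zero_smul h a x }
  exact (LinearMap.isSemisimpleModule_iff_of_bijective f Function.bijective_id).2 inferInstance

lemma isSemisimpleModule_quotient (hA₀ : IsSemisimpleRing (𝒜 0)) {V : Type*}
    [AddCommGroup V] [Module A V] (N : Submodule A V)
    (h : ∀ i, 0 < i → ∀ a ∈ 𝒜 i, ∀ x : V, a • x ∈ N) : IsSemisimpleModule A (V ⧸ N) := by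
  refine isSemisimpleModule_of_smul_eq_zero hA₀ fun i hi a ha x => ?_
  obtain ⟨x, rfl⟩ := N.mkQ_surjective x
  rw [← map_smul]
  exact (Submodule.Quotient.mk_eq_zero N).2 (h i hi a ha x)

lemma GrMod.isSemisimpleModule_quotient_ge (hA₀ : IsSemisimpleRing (𝒜 0)) (M : GrMod 𝒜) (d : ℤ) :
    IsSemisimpleModule A (M.ge d ⧸ (M.ge (d + 1)).submoduleOf (M.ge d)) :=
  isSemisimpleModule_quotient hA₀ _ fun _ hi _ ha x => smul_mem_ge_succ hi ha x.2

lemma GrMod.isSemisimpleModule_quotient_of_head (hA₀ : IsSemisimpleRing (𝒜 0)) {M : GrMod 𝒜}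
    {n : ℤ} (h : HeadInGrade M n) : IsSemisimpleModule A (M.obj ⧸ M.ge (n + 1)) :=
  isSemisimpleModule_quotient hA₀ _ fun _ hi _ ha x =>
    smul_mem_ge_succ hi ha (by rw [ge_eq_top h]; trivial)

end Semisimple

end GradedBridge

/-! ### Dimension shifting along resolutions -/

section DimensionShifting

variable {A : Type u} [Ring A] [IsNoetherianRing A] [HasExt.{w} (FGModuleCat.{u} A)]

/-- Passing from Z to the kernel of p lowers the degree m and raises the index n by one, so N = n +
m is constant. Z ranges over all cokernels of `d n` so that the induction reaches the syzygies. -/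
lemma ext_eq_zero_of_projective_resolution {P : ℕ → FGModuleCat.{u} A}
    (d : ∀ n, P (n + 1) ⟶ P n) (hd : ∀ n, Function.Exact (linOf (d (n + 1))) (linOf (d n)))
    [∀ n, Projective (P n)] {Y : FGModuleCat.{u} A} (m : ℕ) :
    ∀ (n N : ℕ) (_ : n + m = N) (_ : ∀ f : P N ⟶ Y, f = 0) (Z : FGModuleCat.{u} A)
      (p : P n ⟶ Z) (_ : Function.Surjective (linOf p))
      (_ : Function.Exact (linOf (d n)) (linOf p)) (x : Ext Z Y m), x = 0 := by
  induction m with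
  | zero =>
    rintro n _ rfl h Z p hp - x
    refine ext_zero_eq_zero (fun f => ?_) x
    have : Epi p := (epi_iff_surjective p).2 hp
    rw [← cancel_epi p, h (p ≫ f), comp_zero]
  | succ m ih =>
    intro n N hN h Z p hp hdp x
    let K := FGModuleCat.of A (LinearMap.ker (linOf p))
    let i : K ⟶ P n := homOf (Submodule.subtype _)
    have hip : Function.Exact (linOf i) (linOf p) := LinearMap.exact_subtype_ker_map (linOf p)
    have hS := shortExact_of_exact i p (Submodule.injective_subtype _) hp hip
    let r : P (n + 1) ⟶ K :=
      homOf ((linOf (d n)).codRestrict _ fun x => hdp.apply_apply_eq_zero x)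
    refine ext_eq_zero_right_end hS (ih (n + 1) N (by lia) h K r ?_ ?_)
      (fun y => Ext.eq_zero_of_projective y) x
    · rintro ⟨y, hy⟩
      obtain ⟨z, rfl⟩ := (hdp y).1 hy
      exact ⟨z, rfl⟩
    · intro y
      rw [← hd n y]
      exact Subtype.ext_iff

lemma ext_eq_zero_of_injective_resolution {I : ℕ → FGModuleCat.{u} A}
    (d : ∀ n, I n ⟶ I (n + 1)) (hd : ∀ n, Function.Exact (linOf (d n)) (linOf (d (n + 1))))
    [∀ n, Injective (I n)] {X : FGModuleCat.{u} A} (m : ℕ) :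
    ∀ (n N : ℕ) (_ : n + m = N) (_ : ∀ f : X ⟶ I N, f = 0) (Z : FGModuleCat.{u} A)
      (i : Z ⟶ I n) (_ : Function.Injective (linOf i))
      (_ : Function.Exact (linOf i) (linOf (d n))) (x : Ext X Z m), x = 0 := by
  induction m with
  | zero =>
    rintro n _ rfl h Z i hi - x
    refine ext_zero_eq_zero (fun f => ?_) x
    have : Mono i := (mono_iff_injective i).2 hi
    rw [← cancel_mono i, h (f ≫ i), zero_comp]
  | succ m ih =>
    intro n N hN h Z i hi hid x
    let R := FGModuleCat.of A (LinearMap.range (linOf (d n)))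
    let p : I n ⟶ R := homOf (LinearMap.rangeRestrict (linOf (d n)))
    let j : R ⟶ I (n + 1) := homOf (Submodule.subtype _)
    have hip : Function.Exact (linOf i) (linOf p) := by
      intro y
      rw [← hid y]
      exact Subtype.ext_iff
    have hS := shortExact_of_exact i p hi (LinearMap.surjective_rangeRestrict _) hip
    refine ext_eq_zero_left_end hS (ih (n + 1) N (by lia) h R j (Submodule.injective_subtype _) ?_)
      (fun y => Ext.eq_zero_of_injective y) x
    intro y
    rw [hd n y]
    exact ⟨fun hy => ⟨⟨y, hy⟩, rfl⟩, by rintro ⟨z, rfl⟩; exact z.2⟩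

end DimensionShifting

/-! ### Extension and factorization of linear maps -/

section Extension

variable {A : Type*} [Ring A]

/-- φ descends to the image of U in the semisimple module V/N, and extends from that submodule. -/
lemma exists_extension_of_semisimple_quotient {U V W : Type*} [AddCommGroup U] [Module A U]
    [AddCommGroup V] [Module A V] [AddCommGroup W] [Module A W] (N : Submodule A V)
    [IsSemisimpleModule A (V ⧸ N)] (f : U →ₗ[A] V) (φ : U →ₗ[A] W)
    (h : ∀ x, f x ∈ N → φ x = 0) :
    ∃ Φ : V →ₗ[A] W, (∀ x, Φ (f x) = φ x) ∧ ∀ v ∈ N, Φ v = 0 := by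
  have h1 : LinearMap.ker (N.mkQ.comp f) ≤ LinearMap.ker φ := fun x hx =>
    h x ((Submodule.Quotient.mk_eq_zero N).1 hx)
  obtain ⟨g, hg⟩ := IsSemisimpleModule.extension_property
    ((LinearMap.ker (N.mkQ.comp f)).liftQ (N.mkQ.comp f) le_rfl)
    (LinearMap.ker_eq_bot.1 (Submodule.ker_liftQ_eq_bot _ _ _ le_rfl))
    ((LinearMap.ker (N.mkQ.comp f)).liftQ φ h1)
  refine ⟨g.comp N.mkQ, fun x => ?_, fun v hv => ?_⟩
  · have := LinearMap.congr_fun hg ((LinearMap.ker (N.mkQ.comp f)).mkQ x)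
    simpa using this
  · have : N.mkQ v = 0 := (Submodule.Quotient.mk_eq_zero N).2 hv
    rw [LinearMap.comp_apply, this, map_zero]

lemma exists_factor_of_surjective {U V W : Type*} [AddCommGroup U] [Module A U]
    [AddCommGroup V] [Module A V] [AddCommGroup W] [Module A W] {e : U →ₗ[A] V}
    (he : Function.Surjective e) (ψ : U →ₗ[A] W) (h : LinearMap.ker e ≤ LinearMap.ker ψ) :
    ∃ f : V →ₗ[A] W, ∀ x, f (e x) = ψ x := by
  refine ⟨((LinearMap.ker e).liftQ ψ h).comp (e.quotKerEquivOfSurjective he).symm.toLinearMap,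
    fun x => ?_⟩
  have : (e.quotKerEquivOfSurjective he).symm (e x) = (LinearMap.ker e).mkQ x := by
    rw [LinearEquiv.symm_apply_eq]
    rfl
  rw [LinearMap.comp_apply, LinearEquiv.coe_coe, this]
  rfl

end Extension

/-! ### Linear modules: parity along the projective resolution -/

section Linear

variable {k : Type u'} [Field k] {A : Type u} [Ring A] [Algebra k A] {𝒜 : ℕ → Submodule k A}
  [GradedAlgebra 𝒜]

namespace GrMod

/-- A homomorphism from `R` that kills the kernel of the graded map `d : R ⟶ P` extends along `d`
to the part of `P` in which the head of `R` lives. -/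
lemma exists_extension_ge (hA₀ : IsSemisimpleRing (𝒜 0)) {R P : GrMod 𝒜} {d : R.obj ⟶ P.obj}
    (hd : PreservesGrade R P d) {n : ℤ} (hR : HeadInGrade R n) {W : Type*} [AddCommGroup W]
    [Module A W] [IsSimpleModule A W] (ψ : R.obj →ₗ[A] W)
    (hψ : ∀ x, linOf d x = 0 → ψ x = 0) :
    ∃ Φ : P.ge n →ₗ[A] W, (∀ (x) (hx : linOf d x ∈ P.ge n), Φ ⟨linOf d x, hx⟩ = ψ x) ∧
      ∀ v : P.ge n, (v : P.obj) ∈ P.ge (n + 1) → Φ v = 0 := by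
  have := P.isSemisimpleModule_quotient_ge hA₀ n
  have hmem : ∀ x : R.obj, linOf d x ∈ P.ge n := fun x =>
    map_mem_ge hd (by rw [ge_eq_top hR]; trivial)
  obtain ⟨Φ, h1, h2⟩ := exists_extension_of_semisimple_quotient
    ((P.ge (n + 1)).submoduleOf (P.ge n)) ((linOf d).codRestrict _ hmem) ψ (fun x hx => by
      have hx : linOf d x ∈ P.ge (n + 1) := hx
      -- The component of x in grade n is killed by d, hence by ψ; the rest of x lies in higher
      -- grades, hence in the radical, and ψ kills it as well.
      have h3 := hx n (by lia)
      rw [proj_map hd] at h3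
      have h4 := jacobson_le_ker_of_simple ψ (ge_succ_le_jacobson hR
        (sub_proj_mem_ge (x := x) (d := n) (by rw [ge_eq_top hR]; trivial)))
      rw [LinearMap.mem_ker, map_sub, hψ _ h3, sub_zero] at h4
      exact h4)
  exact ⟨Φ, fun x hx => h1 x, fun v hv => h2 v hv⟩

end GrMod

/-- Minimality of the resolution: R is generated in grade n + 1, so its image lies in the radical of
P. -/
lemma GrMod.ker_le_jacobson {R P Q : GrMod 𝒜} {d : R.obj ⟶ P.obj}
    {e : P.obj ⟶ Q.obj} (hd : PreservesGrade R P d) (hde : Function.Exact (linOf d) (linOf e))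
    {n : ℤ} (hP : HeadInGrade P n) (hR : HeadInGrade R (n + 1)) {x : P.obj}
    (hx : linOf e x = 0) : x ∈ Module.jacobson A P.obj := by
  obtain ⟨y, rfl⟩ := (hde x).1 hx
  exact GrMod.ge_succ_le_jacobson hP (GrMod.map_mem_ge hd (by rw [GrMod.ge_eq_top hR]; trivial))

variable [IsNoetherianRing A] [IsArtinianRing A] [HasExt.{w} (FGModuleCat.{u} A)]
  {Λ : Type v} [PartialOrder Λ] {H : HighestWeight (FGModuleCat.{u} A) Λ}

open GrMod

/-- If all these Ext^1 vanished, the extension of ψ to `P.ge (n + 1)` would extend to P, the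
quotient being the semisimple head. But a map to an irreducible module kills `P.ge (n + 1)`, which
lies in the radical. -/
lemma linear_step (hA₀ : IsSemisimpleRing (𝒜 0)) {R P : GrMod 𝒜} {d : R.obj ⟶ P.obj}
    (hd : PreservesGrade R P d) {n : ℤ} (hP : HeadInGrade P n) (hR : HeadInGrade R (n + 1))
    {mu : Λ} (ψ : R.obj →ₗ[A] H.L mu) (h0 : ψ ≠ 0) (hψ : ∀ x, linOf d x = 0 → ψ x = 0) :
    ∃ (lam : Λ) (q : P.obj →ₗ[A] H.L lam), q ≠ 0 ∧ ∃ x : Ext (H.L lam) (H.L mu) 1, x ≠ 0 := by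
  by_contra hcon
  push Not at hcon
  have := isSemisimpleModule_quotient_of_head hA₀ hP
  obtain ⟨Φ, h1, -⟩ := exists_extension_ge hA₀ hd hR ψ hψ
  obtain ⟨g, hg⟩ := exists_linear_extension (P.ge (n + 1))
    (ext_eq_zero_of_semisimple_left (H := H) (fun lam f hf => hcon lam (f.comp (P.ge (n + 1)).mkQ)
      (fun h => hf (by
        rw [← LinearMap.cancel_right (Submodule.mkQ_surjective (P.ge (n + 1))), h]; rfl)))) Φ
  refine h0 (LinearMap.ext fun x => ?_)
  have hx : linOf d x ∈ P.ge (n + 1) := map_mem_ge hd (by rw [ge_eq_top hR]; trivial)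
  rw [← h1 x hx, ← hg _ hx]
  exact jacobson_le_ker_of_simple g (ge_succ_le_jacobson hP hx)

/-- In a linear module all of whose irreducible quotients have length of parity `ε`, the group
`Ext^n(M, L lam)` vanishes unless the parity of `l lam` is that of `ε + n`. -/
lemma parity_of_isLinear (hA₀ : IsSemisimpleRing (𝒜 0)) {l : Λ → ℤ}
    (hExt : ∀ lam₁ lam₂ : Λ, l lam₁ ≡ l lam₂ [ZMOD 2] →
      Subsingleton (Ext (H.L lam₁) (H.L lam₂) 1)) {D : GrMod 𝒜} (hD : IsLinear D) {ε : ℤ}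
    (hε : ∀ (lam : Λ) (f : D.obj →ₗ[A] H.L lam), f ≠ 0 → l lam ≡ ε [ZMOD 2])
    (m : ℕ) (lam : Λ) (x : Ext D.obj (H.L lam) m) (hx : x ≠ 0) : l lam ≡ ε + m [ZMOD 2] := by
  obtain ⟨P, d, e, hd, -, hes, he, hdd, hP, hh⟩ := hD
  have key : ∀ (n : ℕ) (lam : Λ) (ψ : (P n).obj →ₗ[A] H.L lam), ψ ≠ 0 →
      l lam ≡ ε + n [ZMOD 2] := by
    intro n
    induction n with
    | zero =>
      intro lam ψ hψ
      have hk : LinearMap.ker (linOf e) ≤ LinearMap.ker ψ := fun x hx =>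
        jacobson_le_ker_of_simple ψ (GrMod.ker_le_jacobson (hd 0) he (hh 0) (by simpa using hh 1) hx)
      have hes : Function.Surjective (linOf e) := hes
      obtain ⟨f, hf⟩ := exists_factor_of_surjective hes ψ hk
      simpa using hε lam f (fun h => hψ (LinearMap.ext fun x => by rw [← hf, h]; rfl))
    | succ n ih =>
      intro mu ψ hψ
      obtain ⟨lam, q, hq, y, hy⟩ := linear_step hA₀ (hd n) (hh n)
        (by simpa using hh (n + 1)) ψ hψ
        (fun x hx => jacobson_le_ker_of_simple ψ (GrMod.ker_le_jacobson (hd (n + 1)) (hdd n)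
          (hh (n + 1)) (by simpa using hh (n + 1 + 1)) hx))
      have h1 := ih lam q hq
      have h2 : ¬ l lam ≡ l mu [ZMOD 2] := fun h => hy ((hExt _ _ h).elim _ _)
      simp only [Int.ModEq] at *
      push_cast
      lia
  by_contra hcon
  refine hx (ext_eq_zero_of_projective_resolution (P := fun n => (P n).obj) d hdd m 0 m
    (by simp) (fun f => ?_) D.obj e hes he x)
  by_contra hf
  exact hcon (key m lam (linOf f) fun h => hf (linOf_injective h))

end Linear

/-! ### Colinear modules: parity along the injective resolution -/

section Colinear

variable {k : Type u'} [Field k] {A : Type u} [Ring A] [Algebra k A] {𝒜 : ℕ → Submodule k A}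

open GrMod

lemma range_isSimpleModule {V W : Type*} [AddCommGroup V] [Module A V] [AddCommGroup W]
    [Module A W] [IsSimpleModule A V] {f : V →ₗ[A] W} (hf : f ≠ 0) :
    IsSimpleModule A (LinearMap.range f) :=
  IsSimpleModule.congr (LinearEquiv.ofInjective f (LinearMap.injective_of_ne_zero hf)).symm

lemma mem_comp_of_simple {M : GrMod 𝒜} {s : ℤ} (h : SocleInGrade M s) {V : Type*}
    [AddCommGroup V] [Module A V] [IsSimpleModule A V] (f : V →ₗ[A] M.obj) (v : V) :
    f v ∈ M.comp s := by
  by_cases hf : f = 0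
  · rw [hf]
    exact (M.comp s).zero_mem
  · exact h _ (le_sSup (show LinearMap.range f ∈ {S : Submodule A M.obj | IsSimpleModule A S} from
      range_isSimpleModule hf) ⟨v, rfl⟩)

variable [GradedAlgebra 𝒜] [IsArtinianRing A]

/-- The elements of grade at least that of the socle form a semisimple submodule. -/
lemma isSemisimpleModule_ge_of_socle (hA₀ : IsSemisimpleRing (𝒜 0)) {M : GrMod 𝒜} {s : ℤ}
    (h : SocleInGrade M s) : IsSemisimpleModule A (M.ge s) :=
  isSemisimpleModule_of_smul_eq_zero hA₀ fun i hi a ha x => Subtype.ext (by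
    have := smul_mem_ge_succ hi ha x.2
    rwa [ge_succ_eq_bot h] at this)

lemma map_eq_zero_of_socle {P R : GrMod 𝒜} {d : P.obj ⟶ R.obj} (hd : PreservesGrade P R d) {s : ℤ}
    (hR : SocleInGrade R (s - 1)) {x : P.obj} (hx : x ∈ P.ge s) : linOf d x = 0 := by
  have h1 : linOf d x ∈ R.ge (s - 1 + 1) := by
    rw [sub_add_cancel]
    exact map_mem_ge hd hx
  rwa [ge_succ_eq_bot hR] at h1

variable [IsNoetherianRing A] [HasExt.{w} (FGModuleCat.{u} A)]
  {Λ : Type v} [PartialOrder Λ] {H : HighestWeight (FGModuleCat.{u} A) Λ}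

/-- If all these Ext^1 vanished, then Ext^1 from `L mu` to the semisimple submodule `P.ge s` would
vanish. So ψ, lifted through d to `P.ge (s - 1)` modulo `P.ge s`, would lift further to a map into
P. That map lands in the socle, so in `P.ge s`, which d kills. -/
lemma colinear_step (hA₀ : IsSemisimpleRing (𝒜 0)) {P R : GrMod 𝒜} {d : P.obj ⟶ R.obj}
    (hd : PreservesGrade P R d) {s : ℤ} (hP : SocleInGrade P s) (hR : SocleInGrade R (s - 1))
    {mu : Λ} (ψ : H.L mu →ₗ[A] R.obj) (h0 : ψ ≠ 0) (hψ : ∀ y, ∃ x, linOf d x = ψ y) :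
    ∃ (lam : Λ) (q : H.L lam →ₗ[A] P.obj), q ≠ 0 ∧ ∃ x : Ext (H.L mu) (H.L lam) 1, x ≠ 0 := by
  by_contra hcon
  push Not at hcon
  have := isSemisimpleModule_ge_of_socle hA₀ hP
  have hss := P.isSemisimpleModule_quotient_ge hA₀ (s - 1)
  rw [sub_add_cancel] at hss
  let δ : (P.ge (s - 1) ⧸ (P.ge s).submoduleOf (P.ge (s - 1))) →ₗ[A] R.obj :=
    Submodule.liftQ _ ((linOf d).comp (Submodule.subtype _)) fun x hx =>
      map_eq_zero_of_socle hd hR hx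
  have hψδ : ∀ y, ψ y ∈ LinearMap.range δ := by
    intro y
    obtain ⟨x, hx⟩ := hψ y
    -- ψ y is homogeneous of grade s - 1, so the component of x in that grade is already a preimage.
    have h1 : P.proj (s - 1) x ∈ P.ge (s - 1) := mem_ge_of_mem_comp (P.proj_mem _ _) le_rfl
    refine ⟨Submodule.mkQ _ ⟨_, h1⟩, ?_⟩
    change linOf d (P.proj (s - 1) x) = ψ y
    rw [← proj_map hd, hx, R.proj_of_mem (mem_comp_of_simple hR ψ y)]
  obtain ⟨h, hh⟩ := IsSemisimpleModule.lifting_property δ.rangeRestrict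
    (LinearMap.surjective_rangeRestrict δ) (ψ.codRestrict _ hψδ)
  obtain ⟨g, hg⟩ := exists_linear_lifting (P.ge s)
    (ext_eq_zero_of_semisimple_right (H := H) (Y := FGModuleCat.of A (P.ge s))
      (fun lam f hf => hcon lam ((P.ge s).subtype.comp f) (fun h => hf (by
        rw [← LinearMap.cancel_left (Submodule.injective_subtype (P.ge s)), h]
        exact LinearMap.comp_zero _ |>.symm))))
    ((Submodule.mapQ ((P.ge s).submoduleOf (P.ge (s - 1))) (P.ge s)
      (P.ge (s - 1)).subtype fun x hx => hx).comp h)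
  refine h0 (LinearMap.ext fun y => ?_)
  have hy : ψ y = δ (h y) := (congrArg Subtype.val (LinearMap.congr_fun hh y)).symm
  obtain ⟨z, hz⟩ := Submodule.mkQ_surjective _ (h y)
  have h2 := hg y
  have h3 : (P.ge s).mkQ (g y) = 0 := (Submodule.Quotient.mk_eq_zero _).2
    (mem_ge_of_mem_comp (mem_comp_of_simple hP g y) le_rfl)
  rw [h3, LinearMap.comp_apply, ← hz] at h2
  have h4 : (z : P.obj) ∈ P.ge s := (Submodule.Quotient.mk_eq_zero _).1 h2.symm
  rw [hy, ← hz]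
  exact map_eq_zero_of_socle hd hR h4

/-- If `D` is colinear and all its irreducible submodules have length of parity `ε`, then
`Ext^n(L lam, D)` vanishes unless the parity of `l lam` is that of `ε + n`. -/
lemma parity_of_isColinear (hA₀ : IsSemisimpleRing (𝒜 0)) {l : Λ → ℤ}
    (hExt : ∀ lam₁ lam₂ : Λ, l lam₁ ≡ l lam₂ [ZMOD 2] →
      Subsingleton (Ext (H.L lam₁) (H.L lam₂) 1)) {D : GrMod 𝒜} (hD : IsColinear D) {ε : ℤ}
    (hε : ∀ (lam : Λ) (f : H.L lam →ₗ[A] D.obj), f ≠ 0 → l lam ≡ ε [ZMOD 2])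
    (m : ℕ) (lam : Λ) (x : Ext (H.L lam) D.obj m) (hx : x ≠ 0) : l lam ≡ ε + m [ZMOD 2] := by
  obtain ⟨I, d, e, hd, -, hei, he, hdd, hI, hs⟩ := hD
  have hs' : ∀ n : ℕ, SocleInGrade (I (n + 1)) (-n - 1) := fun n => by
    have := hs (n + 1)
    rwa [Nat.cast_succ, neg_add, ← sub_eq_add_neg] at this
  have key : ∀ (n : ℕ) (lam : Λ) (ψ : H.L lam →ₗ[A] (I n).obj), ψ ≠ 0 →
      l lam ≡ ε + n [ZMOD 2] := by
    intro n
    induction n with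
    | zero =>
      intro lam ψ hψ
      have hei : Function.Injective (linOf e) := hei
      -- ψ y has grade 0 while I 1 lives in grades at most -1, so d kills ψ y.
      have hr : ∀ y, ψ y ∈ LinearMap.range (linOf e) := fun y =>
        (he (ψ y)).1 (map_eq_zero_of_socle (hd 0) (hs' 0)
          (mem_ge_of_mem_comp (mem_comp_of_simple (hs 0) ψ y) le_rfl))
      let f : H.L lam →ₗ[A] D.obj := (LinearEquiv.ofInjective (linOf e) hei).symm.toLinearMap.comp
        (ψ.codRestrict _ hr)
      have hf : ∀ y, linOf e (f y) = ψ y := fun y =>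
        congrArg Subtype.val ((LinearEquiv.ofInjective (linOf e) hei).apply_symm_apply ⟨ψ y, hr y⟩)
      simpa using hε lam f (fun h => hψ (LinearMap.ext fun y => by rw [← hf, h]; simp))
    | succ n ih =>
      intro mu ψ hψ
      obtain ⟨lam, q, hq, y, hy⟩ := colinear_step hA₀ (hd n) (hs n) (hs' n) ψ hψ
        (fun y => (hdd n (ψ y)).1 (map_eq_zero_of_socle (hd (n + 1)) (hs' (n + 1))
          (mem_ge_of_mem_comp (mem_comp_of_simple (hs (n + 1)) ψ y) le_rfl)))
      have h1 := ih lam q hq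
      have h2 : ¬ l mu ≡ l lam [ZMOD 2] := fun h => hy ((hExt _ _ h).elim _ _)
      simp only [Int.ModEq] at *
      push_cast
      lia
  by_contra hcon
  refine hx (ext_eq_zero_of_injective_resolution (I := fun n => (I n).obj) d hdd m 0 m
    (by simp) (fun f => ?_) D.obj e hei he x)
  by_contra hf
  exact hcon (key m lam (linOf f) fun h => hf (linOf_injective h))

end Colinear

/-! ### Indecomposable modules and partial isotypic sums -/

section Indecomposable

variable {A : Type u} [Ring A] [IsNoetherianRing A]

lemma eq_bot_of_isZero {X : FGModuleCat.{u} A} {p : Submodule A X}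
    (h : IsZero (FGModuleCat.of A p)) : p = ⊥ := by
  rw [eq_bot_iff]
  intro x hx
  have h1 := congrArg (fun f : FGModuleCat.of A p ⟶ FGModuleCat.of A p => linOf f (⟨x, hx⟩ : p))
    ((IsZero.iff_id_eq_zero _).1 h)
  exact congrArg Subtype.val h1

lemma eq_bot_or_eq_bot_of_indecomposable {X : FGModuleCat.{u} A} (hX : Indecomposable X)
    {p q : Submodule A X} (h : IsCompl p q) : p = ⊥ ∨ q = ⊥ := by
  let ip : FGModuleCat.of A p ⟶ X := homOf p.subtype
  let iq : FGModuleCat.of A q ⟶ X := homOf q.subtype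
  let rp : X ⟶ FGModuleCat.of A p := homOf (p.projectionOnto q h)
  let rq : X ⟶ FGModuleCat.of A q := homOf (q.projectionOnto p h.symm)
  have h1 : ip ≫ rp = 𝟙 _ := linOf_injective (p.projectionOnto_comp_subtype h)
  have h2 : iq ≫ rq = 𝟙 _ := linOf_injective (q.projectionOnto_comp_subtype h.symm)
  have h3 : ip ≫ rq = 0 :=
    linOf_injective (LinearMap.ext (Submodule.projectionOnto_apply_right h.symm))
  have h4 : iq ≫ rp = 0 := linOf_injective (LinearMap.ext (Submodule.projectionOnto_apply_right h))
  have h5 : rp ≫ ip + rq ≫ iq = 𝟙 X :=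
    linOf_injective (Submodule.projection_add_projection_eq_id h)
  let e : X ≅ FGModuleCat.of A p ⊞ FGModuleCat.of A q :=
    { hom := biprod.lift rp rq
      inv := biprod.desc ip iq
      hom_inv_id := by rw [biprod.lift_desc, h5]
      inv_hom_id := by
        apply biprod.hom_ext' <;> apply biprod.hom_ext <;> simp [h1, h2, h3, h4] }
  exact (hX.2 _ _ e).imp eq_bot_of_isZero eq_bot_of_isZero

lemma indecomposable_of_iso {C : Type u} [Category.{v} C] [Abelian C] {X Y : C}
    (e : X ≅ Y) (h : Indecomposable Y) : Indecomposable X :=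
  ⟨fun hX => h.1 (hX.of_iso e.symm), fun Z W i => h.2 Z W (e.symm ≪≫ i)⟩

lemma exists_endomorphism_lifting {P : FGModuleCat.{u} A} [Projective P] (N : Submodule A P)
    (f : (P ⧸ N) →ₗ[A] P ⧸ N) : ∃ u : P →ₗ[A] P, ∀ x, N.mkQ (u x) = f (N.mkQ x) := by
  let q : P ⟶ FGModuleCat.of A (P ⧸ N) := homOf N.mkQ
  have : Epi q := (epi_iff_surjective q).2 N.mkQ_surjective
  let t : P ⟶ FGModuleCat.of A (P ⧸ N) := homOf (f.comp N.mkQ)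
  have h := Projective.factorThru_comp t q
  exact ⟨linOf (Projective.factorThru t q), fun x => congrArg (fun g => linOf g x) h⟩

section Part

variable {Λ : Type u'} [PartialOrder Λ] (H : HighestWeight (FGModuleCat.{u} A) Λ)

/-- The elements killed by all homomorphisms to `L lam` with `lam` not in `T`. In a semisimple
module this is the sum of the isotypic components for the weights in `T`. -/
def HighestWeight.part (T : Set Λ) (V : Type*) [AddCommGroup V] [Module A V] : Submodule A V :=
  ⨅ (lam : Λ) (_ : lam ∉ T) (f : V →ₗ[A] H.L lam), LinearMap.ker f

variable {H}

lemma HighestWeight.mem_part {T : Set Λ} {V : Type*} [AddCommGroup V] [Module A V] {x : V} :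
    x ∈ H.part T V ↔ ∀ lam, lam ∉ T → ∀ f : V →ₗ[A] H.L lam, f x = 0 := by
  simp only [HighestWeight.part, Submodule.mem_iInf, LinearMap.mem_ker]

lemma HighestWeight.linear_eq_zero_of_ne {lam mu : Λ} (h : lam ≠ mu) (f : H.L lam →ₗ[A] H.L mu) :
    f = 0 := by
  by_contra hf
  exact h (H.eq_of_hom_L (f := homOf f) fun h0 => hf (congrArg linOf h0))

/-- A nonzero f would split, and the image of the section lies in the T-part because there are no
maps between distinct irreducibles. -/
lemma HighestWeight.eq_zero_of_part_le_ker {T : Set Λ} {V : Type*} [AddCommGroup V] [Module A V]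
    [IsSemisimpleModule A V] {lam : Λ} (hlam : lam ∈ T) (f : V →ₗ[A] H.L lam)
    (h : ∀ x ∈ H.part T V, f x = 0) : f = 0 := by
  by_contra hf
  obtain ⟨g, hg⟩ := IsSemisimpleModule.lifting_property f (LinearMap.surjective_of_ne_zero hf)
    LinearMap.id
  refine hf (LinearMap.ext fun x => ?_)
  have h1 : f (g (f x)) = f x := LinearMap.congr_fun hg (f x)
  rw [← h1]
  refine h _ (mem_part.2 fun mu hmu q => ?_)
  have : lam ≠ mu := by
    rintro rfl
    exact hmu hlam
  exact LinearMap.congr_fun (linear_eq_zero_of_ne this (q.comp g)) (f x)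

lemma HighestWeight.isCompl_part (T : Set Λ) (V : Type u) [AddCommGroup V] [Module A V]
    [IsSemisimpleModule A V] : IsCompl (H.part T V) (H.part Tᶜ V) := by
  refine IsCompl.of_eq ?_ ?_
  · rw [eq_bot_iff]
    rintro x ⟨h1, h2⟩
    by_contra hx
    obtain ⟨lam, f, hf⟩ := H.exists_linear_apply_ne_zero (V := V) (q := x) hx
    by_cases hlam : lam ∈ T
    · exact hf (mem_part.1 h2 lam (fun h => h hlam) f)
    · exact hf (mem_part.1 h1 lam hlam f)
  · by_contra hT
    have : Nontrivial (V ⧸ (H.part T V ⊔ H.part Tᶜ V)) := Submodule.Quotient.nontrivial_iff.2 hT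
    obtain ⟨q, hq⟩ := exists_ne (0 : V ⧸ (H.part T V ⊔ H.part Tᶜ V))
    obtain ⟨lam, f, hf⟩ := H.exists_linear_apply_ne_zero hq
    have hk : ∀ x ∈ H.part T V ⊔ H.part Tᶜ V,
        (f.comp (Submodule.mkQ (H.part T V ⊔ H.part Tᶜ V))) x = 0 := fun x hx => by
      rw [LinearMap.comp_apply, Submodule.mkQ_apply, (Submodule.Quotient.mk_eq_zero _).2 hx,
        map_zero]
    have h0 : f.comp (Submodule.mkQ (H.part T V ⊔ H.part Tᶜ V)) = 0 := by
      by_cases hlam : lam ∈ T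
      · exact eq_zero_of_part_le_ker hlam _ fun x hx => hk x (Submodule.mem_sup_left hx)
      · exact eq_zero_of_part_le_ker (T := Tᶜ) hlam _ fun x hx => hk x (Submodule.mem_sup_right hx)
    obtain ⟨x, rfl⟩ := Submodule.mkQ_surjective _ q
    exact hf (LinearMap.congr_fun h0 x)

end Part

end Indecomposable

/-! ### Degree zero components of endomorphisms -/

section DegreeZero

variable {k : Type u'} [Field k] {A : Type u} [Ring A] [Algebra k A] {𝒜 : ℕ → Submodule k A}
  [GradedAlgebra 𝒜]

namespace GrMod

/-- Projectivity yields only ungraded lifts; keeping the degree zero component makes them graded,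
and it is A-linear since projections commute with homogeneous scalars up to the shift of grade. -/
lemma exists_degreeZero (M : GrMod 𝒜) (u : M.obj →ₗ[A] M.obj) :
    ∃ v : M.obj →ₗ[A] M.obj, ∀ j, ∀ x ∈ M.comp j, v x = M.proj j (u x) := by
  classical
  let _ := M.isInternal.chooseDecomposition
  let g : M.obj →+ M.obj := (DirectSum.toAddMonoid fun j =>
    (M.proj j).comp (u.toAddMonoidHom.comp (M.comp j).subtype)).comp
      (DirectSum.decomposeAddEquiv M.comp).toAddMonoidHom
  have hg : ∀ j, ∀ x ∈ M.comp j, g x = M.proj j (u x) := by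
    intro j x hx
    change DirectSum.toAddMonoid _ (DirectSum.decompose M.comp x) = _
    rw [DirectSum.decompose_of_mem M.comp hx, DirectSum.toAddMonoid_of]
    rfl
  refine ⟨{ g with map_smul' := fun a x => ?_ }, hg⟩
  change g (a • x) = a • g x
  induction a using DirectSum.Decomposition.inductionOn 𝒜 with
  | zero => simp
  | add a b ha hb => rw [add_smul, map_add, ha, hb, add_smul]
  | @homogeneous i a =>
    induction x using M.induction_homogeneous with
    | h0 => simp
    | hadd x y hx hy => rw [smul_add, map_add, map_add, smul_add, hx, hy]
    | h j =>
      rw [hg j _ (M.proj_mem j x), hg _ _ (M.smul_mem i j a _ a.2 (M.proj_mem j x)), map_smul,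
        M.proj_smul a.2]

end GrMod

end DegreeZero

/-! ### The parity splitting of the head of a linear module -/

section Splitting

variable {k : Type u'} [Field k] {A : Type u} [Ring A] [Algebra k A] {𝒜 : ℕ → Submodule k A}
  [GradedAlgebra 𝒜] [IsNoetherianRing A] [IsArtinianRing A] [HasExt.{w} (FGModuleCat.{u} A)]
  {Λ : Type v} [PartialOrder Λ] {H : HighestWeight (FGModuleCat.{u} A) Λ}

open GrMod

/-- Φ extends to the preimage P' of the T-part of the head, since Ext^1 from that part to `L lam` is
zero. As v maps P into P', the extension composed with v is a map from P to an irreducible module,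
which kills the radical. -/
lemma apply_eq_zero_of_mem_part (hA₀ : IsSemisimpleRing (𝒜 0)) {P : GrMod 𝒜} {n : ℤ}
    (hP : HeadInGrade P n) {T : Set Λ} {lam : Λ}
    (hT : ∀ mu ∈ T, ∀ x : Ext (H.L mu) (H.L lam) 1, x = 0) (v : P.obj →ₗ[A] P.obj)
    (hv : ∀ x, (P.ge (n + 1)).mkQ (v x) ∈ H.part T (P.obj ⧸ P.ge (n + 1)))
    (Φ : P.ge (n + 1) →ₗ[A] H.L lam) {x : P.obj} (hx : x ∈ P.ge (n + 1))
    (hvx : v x ∈ P.ge (n + 1)) : Φ ⟨v x, hvx⟩ = 0 := by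
  have := isSemisimpleModule_quotient_of_head hA₀ hP
  let P' : Submodule A P.obj := (H.part T (P.obj ⧸ P.ge (n + 1))).comap (P.ge (n + 1)).mkQ
  let N : Submodule A P' := (P.ge (n + 1)).submoduleOf P'
  let i : (P' ⧸ N) →ₗ[A] P.obj ⧸ P.ge (n + 1) := Submodule.mapQ _ _ P'.subtype le_rfl
  have hi : Function.Injective i := by
    refine LinearMap.ker_eq_bot.1 (Submodule.ker_liftQ_eq_bot _ _ _ fun z hz => ?_)
    exact (Submodule.Quotient.mk_eq_zero (P.ge (n + 1))).1 hz
  have hss : IsSemisimpleModule A (P' ⧸ N) := IsSemisimpleModule.of_injective i hi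
  have hss' : IsSemisimpleModule A (FGModuleCat.of A (P' ⧸ N)) := hss
  obtain ⟨g, hg⟩ := exists_linear_extension (X := FGModuleCat.of A P') N
    (ext_eq_zero_of_semisimple_left (H := H) (X := FGModuleCat.of A (P' ⧸ N))
      (fun mu f hf => hT mu (by
        by_contra hmu
        obtain ⟨h, hh⟩ := IsSemisimpleModule.extension_property i hi f
        refine hf (LinearMap.ext fun z => ?_)
        rw [← hh]
        obtain ⟨z, rfl⟩ := Submodule.mkQ_surjective _ z
        exact HighestWeight.mem_part.1 z.2 mu hmu h)))
    (Φ.comp ((P'.subtype.comp N.subtype).codRestrict (P.ge (n + 1)) fun z => z.2))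
  have hg' := hg ⟨v x, hv x⟩ hvx
  have h0 := jacobson_le_ker_of_simple
    (LinearMap.comp (g : P' →ₗ[A] H.L lam) (v.codRestrict P' hv)) (ge_succ_le_jacobson hP hx)
  exact hg'.symm.trans h0

lemma degreeZero_mem_range (hA₀ : IsSemisimpleRing (𝒜 0)) {R P : GrMod 𝒜} {d : R.obj ⟶ P.obj}
    (hd : PreservesGrade R P d) {n : ℤ} (hP : HeadInGrade P n) (hR : HeadInGrade R (n + 1))
    {T : Set Λ}
    (hT : ∀ lam mu : Λ, (lam ∈ T ↔ mu ∈ T) → ∀ x : Ext (H.L lam) (H.L mu) 1, x = 0)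
    (u v : P.obj →ₗ[A] P.obj)
    (hu : ∀ x, (P.ge (n + 1)).mkQ (u x) ∈ H.part T (P.obj ⧸ P.ge (n + 1)))
    (hu' : ∀ x, (P.ge (n + 1)).mkQ (x - u x) ∈ H.part Tᶜ (P.obj ⧸ P.ge (n + 1)))
    (hug : ∀ x ∈ P.ge (n + 1), u x ∈ P.ge (n + 1))
    (hv : ∀ j, ∀ x ∈ P.comp j, v x = P.proj j (u x)) (r : R.obj) :
    v (linOf d r) ∈ LinearMap.range (linOf d) := by
  let K := LinearMap.range (linOf d)
  have hKge : ∀ r, linOf d r ∈ P.ge (n + 1) := fun r =>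
    map_mem_ge hd (by rw [ge_eq_top hR]; trivial)
  suffices h : Submodule.span A (R.comp (n + 1) : Set R.obj) ≤ K.comap (v.comp (linOf d)) from
    h (by rw [span_comp_eq_top hR]; trivial)
  rw [Submodule.span_le]
  intro r hr
  change v (linOf d r) ∈ K
  have hw : linOf d r ∈ P.comp (n + 1) := hd _ _ hr
  -- Otherwise some Φ to an irreducible `L lam` kills K and is nonzero at u w, where w = d r. For
  -- lam in T, Φ vanishes on u w; for lam outside T it vanishes on w - u w, and w lies in K. Taking
  -- components of grade n + 1 then discards the higher grades.
  have hsup : u (linOf d r) ∈ K ⊔ P.ge (n + 1 + 1) := by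
    let N : Submodule A (P.ge (n + 1)) := (K ⊔ P.ge (n + 1 + 1)).submoduleOf (P.ge (n + 1))
    have : IsSemisimpleModule A (P.ge (n + 1) ⧸ N) :=
      isSemisimpleModule_quotient hA₀ _ fun i hi a ha x =>
        Submodule.mem_sup_right (smul_mem_ge_succ hi ha x.2)
    by_contra hcon
    have hq : N.mkQ ⟨_, hug _ (hKge r)⟩ ≠ 0 := fun h =>
      hcon ((Submodule.Quotient.mk_eq_zero N).1 h)
    obtain ⟨lam, f, hf⟩ := H.exists_linear_apply_ne_zero hq
    by_cases hlam : lam ∈ T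
    · exact hf (apply_eq_zero_of_mem_part hA₀ hP
        (fun mu hmu => hT mu lam ⟨fun _ => hlam, fun _ => hmu⟩) u hu (f.comp N.mkQ) (hKge r) _)
    · have hm := Submodule.sub_mem _ (hKge r) (hug _ (hKge r))
      have h1 := apply_eq_zero_of_mem_part hA₀ hP
        (fun mu hmu => hT mu lam ⟨fun h => absurd h hmu, fun h => absurd h hlam⟩)
        (LinearMap.id - u) hu' (f.comp N.mkQ) (hKge r) hm
      have h2 : N.mkQ ⟨_, hKge r⟩ = 0 := (Submodule.Quotient.mk_eq_zero N).2
        (Submodule.mem_sup_left ⟨r, rfl⟩)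
      have h3 : (⟨linOf d r - u (linOf d r), hm⟩ : P.ge (n + 1)) =
        ⟨_, hKge r⟩ - ⟨_, hug _ (hKge r)⟩ := rfl
      have h1 : f (N.mkQ ⟨linOf d r - u (linOf d r), hm⟩) = 0 := h1
      rw [h3, map_sub, map_sub, h2, map_zero, zero_sub, neg_eq_zero] at h1
      exact hf h1
  obtain ⟨_, ⟨r', rfl⟩, g, hg, hrg⟩ := Submodule.mem_sup.1 hsup
  rw [hv _ _ hw, ← hrg, map_add, hg _ (by lia), add_zero, proj_map hd]
  exact ⟨_, rfl⟩

/-- E is induced by the degree zero component of a lift of the projection of the head onto its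
T-part. Maps from D to irreducibles factor through the head, where this component acts as that
projection. -/
lemma exists_endomorphism_of_presentation (hA₀ : IsSemisimpleRing (𝒜 0)) {R P : GrMod 𝒜}
    {d : R.obj ⟶ P.obj} (hd : PreservesGrade R P d) {n : ℤ} (hP : HeadInGrade P n)
    (hR : HeadInGrade R (n + 1)) [Projective P.obj] {D : FGModuleCat.{u} A} {e : P.obj ⟶ D}
    (he : Function.Surjective (linOf e)) (hde : Function.Exact (linOf d) (linOf e)) (T : Set Λ)
    (hT : ∀ lam mu : Λ, (lam ∈ T ↔ mu ∈ T) → ∀ x : Ext (H.L lam) (H.L mu) 1, x = 0) :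
    ∃ E : D →ₗ[A] D, (∀ lam ∈ T, ∀ (f : D →ₗ[A] H.L lam) (x : D), f (E x) = f x) ∧
      ∀ lam, lam ∉ T → ∀ (f : D →ₗ[A] H.L lam) (x : D), f (E x) = 0 := by
  have := isSemisimpleModule_quotient_of_head hA₀ hP
  have hc := HighestWeight.isCompl_part (H := H) T (P.obj ⧸ P.ge (n + 1))
  obtain ⟨u, hu⟩ := exists_endomorphism_lifting (P.ge (n + 1)) (Submodule.projection _ _ hc)
  obtain ⟨v, hv⟩ := P.exists_degreeZero u
  have hvK := degreeZero_mem_range (H := H) hA₀ hd hP hR hT u v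
    (fun x => by
      rw [hu]
      exact Submodule.projection_apply_mem hc _)
    (fun x => by
      rw [map_sub, hu, ← Submodule.projection_eq_self_sub_projection]
      exact Submodule.projection_apply_mem hc.symm _)
    (fun x hx => (Submodule.Quotient.mk_eq_zero (P.ge (n + 1))).1 (by
      have h1 := hu x
      have h2 : (P.ge (n + 1)).mkQ x = 0 := (Submodule.Quotient.mk_eq_zero _).2 hx
      rwa [h2, map_zero] at h1))
    hv
  obtain ⟨E, hE⟩ := exists_factor_of_surjective he ((linOf e).comp v) (fun x hx => by
    obtain ⟨r, rfl⟩ := (hde x).1 hx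
    exact (hde _).2 (hvK r))
  -- a map to an irreducible module factors through the head, on which `v` acts as `u`
  have key : ∀ (lam : Λ) (f : D →ₗ[A] H.L lam), ∃ g : (P.obj ⧸ P.ge (n + 1)) →ₗ[A] H.L lam,
      (∀ p, f (linOf e p) = g ((P.ge (n + 1)).mkQ p)) ∧
      ∀ p ∈ P.comp n, f (linOf e (v p)) = g (Submodule.projection _ _ hc ((P.ge (n + 1)).mkQ p)) := by
    intro lam f
    have hk : P.ge (n + 1) ≤ LinearMap.ker (f.comp (linOf e)) :=
      (ge_succ_le_jacobson hP).trans (jacobson_le_ker_of_simple _)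
    refine ⟨(P.ge (n + 1)).liftQ _ hk, fun p => rfl, fun p hp => ?_⟩
    rw [← hu, hv n p hp]
    have h1 := hk (sub_proj_mem_ge (x := u p) (d := n) (by rw [ge_eq_top hP]; trivial))
    rw [LinearMap.mem_ker, map_sub, sub_eq_zero] at h1
    exact h1.symm
  refine ⟨E, fun lam hlam f => ?_, fun lam hlam f => ?_⟩
  · obtain ⟨g, h1, h2⟩ := key lam f
    have h3 : ((f.comp (linOf e)).comp v) = f.comp (linOf e) := by
      refine LinearMap.ext_on (span_comp_eq_top hP) fun p hp => ?_
      have h4 := HighestWeight.mem_part.1 (Submodule.projection_apply_mem hc.symm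
        ((P.ge (n + 1)).mkQ p)) lam (fun h => h hlam) g
      rw [Submodule.projection_eq_self_sub_projection hc, map_sub, sub_eq_zero] at h4
      exact (h2 p hp).trans (h4.symm.trans (h1 p).symm)
    intro x
    obtain ⟨p, rfl⟩ := he x
    rw [hE]
    exact LinearMap.congr_fun h3 p
  · obtain ⟨g, h1, h2⟩ := key lam f
    have h3 : ((f.comp (linOf e)).comp v) = 0 := by
      refine LinearMap.ext_on (span_comp_eq_top hP) fun p hp => ?_
      exact (h2 p hp).trans (HighestWeight.mem_part.1 (Submodule.projection_apply_mem hc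
        ((P.ge (n + 1)).mkQ p)) lam hlam g)
    intro x
    obtain ⟨p, rfl⟩ := he x
    rw [hE]
    exact LinearMap.congr_fun h3 p

/-- The irreducible quotients of an indecomposable linear module belong to one class, if there are
two classes of weights with no extensions between irreducible modules of the same class. -/
lemma weights_of_indecomposable (hA₀ : IsSemisimpleRing (𝒜 0)) {D : GrMod 𝒜}
    (hD : IsLinear D) (hind : Indecomposable D.obj) (T : Set Λ)
    (hT : ∀ lam mu : Λ, (lam ∈ T ↔ mu ∈ T) → ∀ x : Ext (H.L lam) (H.L mu) 1, x = 0) :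
    (∀ (lam : Λ) (f : D.obj →ₗ[A] H.L lam), f ≠ 0 → lam ∈ T) ∨
      (∀ (lam : Λ) (f : D.obj →ₗ[A] H.L lam), f ≠ 0 → lam ∉ T) := by
  obtain ⟨P, d, e, hd, -, hes, he, -, hP, hh⟩ := hD
  obtain ⟨E, hE₁, hE₀⟩ := exists_endomorphism_of_presentation (H := H) hA₀ (hd 0) (hh 0)
    (by simpa using hh 1) hes he T hT
  -- Fitting's lemma. The exponent N + 1 is positive, so the power has an outer factor E: if it is
  -- surjective, weights outside T do not occur; if it is zero, weights in T do not.
  obtain ⟨N, hN⟩ := Filter.eventually_atTop.1 (LinearMap.eventually_isCompl_ker_pow_range_pow E)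
  have hc := hN (N + 1) (by lia)
  rcases eq_bot_or_eq_bot_of_indecomposable hind hc with h | h
  · left
    intro lam f hf
    by_contra hlam
    rw [h] at hc
    have hr := hc.codisjoint.eq_top
    rw [bot_sup_eq] at hr
    refine hf (LinearMap.ext fun x => ?_)
    obtain ⟨y, rfl⟩ := LinearMap.range_eq_top.1 hr x
    rw [pow_succ']
    exact hE₀ lam hlam f _
  · right
    intro lam f hf hlam
    refine hf (LinearMap.ext fun x => ?_)
    have h1 : ∀ m : ℕ, f ((E ^ m) x) = f x := by
      intro m
      induction m with
      | zero => simp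
      | succ m ih =>
        rw [pow_succ']
        exact (hE₁ lam hlam f _).trans ih
    rw [← h1 (N + 1), LinearMap.range_eq_bot.1 h, LinearMap.zero_apply, map_zero,
      LinearMap.zero_apply]

end Splitting

/-! ### Parity of linear modules and Kazhdan-Lusztig theory -/

section Main

variable {A : Type u} [Ring A]

lemma linear_ne_zero_of_iso {X Y Z : FGModuleCat.{u} A} (i : X ≅ Y) {f : X →ₗ[A] Z} (hf : f ≠ 0) :
    i.inv ≫ homOf f ≠ 0 := fun h => hf (congrArg linOf
      ((cancel_epi i.inv).1 (h.trans comp_zero.symm) : homOf f = 0))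

lemma linear_from_ne_zero_of_iso {X Y Z : FGModuleCat.{u} A} (i : X ≅ Y) {f : Z →ₗ[A] X}
    (hf : f ≠ 0) : homOf f ≫ i.hom ≠ 0 := fun h => hf (congrArg linOf
      ((cancel_mono i.hom).1 (h.trans zero_comp.symm) : homOf f = 0))

variable [IsNoetherianRing A] {Λ : Type v} [PartialOrder Λ] {H : HighestWeight (FGModuleCat.{u} A) Λ}

lemma exists_head_parity {l : Λ → ℤ} {M : FGModuleCat.{u} A} (h : HasHeadOfOneParity H l M) :
    ∃ ε : ℤ, ∀ (lam : Λ) (f : M ⟶ H.L lam), f ≠ 0 → l lam ≡ ε [ZMOD 2] := by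
  by_cases hf : ∃ (lam : Λ) (f : M ⟶ H.L lam), f ≠ 0
  · obtain ⟨mu, g, hg⟩ := hf
    exact ⟨l mu, fun lam f hf =>
      h lam mu f g (epi_of_nonzero_to_simple hf) (epi_of_nonzero_to_simple hg)⟩
  · push Not at hf
    -- Without irreducible quotients any value serves.
    exact ⟨0, fun lam f hf' => absurd (hf lam f) hf'⟩

variable {k : Type u'} [Field k] [Algebra k A] {𝒜 : ℕ → Submodule k A}
  [GradedAlgebra 𝒜] [IsArtinianRing A] [HasExt.{w} (FGModuleCat.{u} A)]

lemma exists_head_parity_of_indecomposable (hA₀ : IsSemisimpleRing (𝒜 0)) {l : Λ → ℤ}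
    (hExt : ∀ lam₁ lam₂ : Λ, l lam₁ ≡ l lam₂ [ZMOD 2] →
      Subsingleton (Ext (H.L lam₁) (H.L lam₂) 1)) {D : GrMod 𝒜} (hD : IsLinear D)
    (hind : Indecomposable D.obj) :
    ∃ ε : ℤ, ∀ (lam : Λ) (f : D.obj →ₗ[A] H.L lam), f ≠ 0 → l lam ≡ ε [ZMOD 2] := by
  have hT : ∀ lam mu : Λ, (lam ∈ {lam | l lam ≡ 0 [ZMOD 2]} ↔ mu ∈ {lam | l lam ≡ 0 [ZMOD 2]}) →
      ∀ x : Ext (H.L lam) (H.L mu) 1, x = 0 := by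
    intro lam mu h x
    refine (hExt lam mu ?_).elim _ _
    simp only [Set.mem_ofPred_eq, Int.ModEq] at h ⊢
    lia
  rcases weights_of_indecomposable (H := H) hA₀ hD hind _ hT with h | h
  · exact ⟨0, fun lam f hf => h lam f hf⟩
  · refine ⟨1, fun lam f hf => ?_⟩
    have := h lam f hf
    simp only [Set.mem_ofPred_eq, Int.ModEq] at this ⊢
    lia

lemma hasParity_of_linear (hA₀ : IsSemisimpleRing (𝒜 0)) {l : Λ → ℤ}
    (hExt : ∀ lam₁ lam₂ : Λ, l lam₁ ≡ l lam₂ [ZMOD 2] →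
      Subsingleton (Ext (H.L lam₁) (H.L lam₂) 1)) {M : FGModuleCat.{u} A}
    (hM : HasLinearLift 𝒜 M) (h : Indecomposable M ∨ HasHeadOfOneParity H l M) :
    HasParity H M := by
  obtain ⟨D, ⟨i⟩, hD⟩ := hM
  obtain ⟨ε, hε⟩ : ∃ ε : ℤ, ∀ (lam : Λ) (f : D.obj →ₗ[A] H.L lam), f ≠ 0 →
      l lam ≡ ε [ZMOD 2] := by
    rcases h with h | h
    · exact exists_head_parity_of_indecomposable hA₀ hExt hD (indecomposable_of_iso i h)
    · obtain ⟨ε, hε⟩ := exists_head_parity h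
      exact ⟨ε, fun lam f hf => hε lam _ (linear_ne_zero_of_iso i hf)⟩
  have hext : ∀ (lam : Λ) (n : ℕ), ¬ l lam ≡ ε + n [ZMOD 2] → Subsingleton (Ext M (H.L lam) n) :=
    fun lam n hn => subsingleton_of_forall_eq 0 (ext_eq_zero_of_iso_left i fun x => by
      by_contra hx
      exact hn (parity_of_isLinear hA₀ hExt hD hε n lam x hx))
  intro lam
  by_cases hl : l lam ≡ ε [ZMOD 2]
  · refine Or.inl fun n hn => hext lam n ?_
    obtain ⟨m, rfl⟩ := hn
    simp only [Int.ModEq] at hl ⊢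
    push_cast
    lia
  · refine Or.inr fun n hn => hext lam n ?_
    obtain ⟨m, rfl⟩ := hn
    simp only [Int.ModEq] at hl ⊢
    push_cast
    lia

/-- The only irreducible quotient of `Delta mu`, and the only irreducible submodule of `nabla mu`,
is `L mu`; so both parity statements apply with ε = l mu. -/
lemma hasKLTheory_of_standardKoszul [Finite Λ] [HasDerivedCategory.{w'} (FGModuleCat.{u} A)]
    (hA₀ : IsSemisimpleRing (𝒜 0)) {l : Λ → ℤ}
    (hExt : ∀ lam₁ lam₂ : Λ, l lam₁ ≡ l lam₂ [ZMOD 2] →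
      Subsingleton (Ext (H.L lam₁) (H.L lam₂) 1)) (hK : IsStandardKoszul 𝒜 H) :
    HasKLTheory H l := by
  refine HighestWeight.hasKLTheory_of_parity isLengthFunction_length
    (fun mu lam p x hx => ?_) (fun mu lam p x hx => ?_)
  · obtain ⟨⟨D, ⟨i⟩, -, hD⟩, -⟩ := hK mu
    have hε : ∀ (nu : Λ) (f : D.obj →ₗ[A] H.L nu), f ≠ 0 → l nu ≡ l mu [ZMOD 2] := by
      intro nu f hf
      rw [HighestWeight.eq_of_isFactor_L
        (HighestWeight.isFactor_of_hom_Delta (linear_ne_zero_of_iso i hf))]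
    by_contra hcon
    refine hx (ext_eq_zero_of_iso_left i (fun y => ?_) x)
    by_contra hy
    have := parity_of_isLinear hA₀ hExt hD hε p lam y hy
    simp only [Int.ModEq] at this hcon
    lia
  · obtain ⟨-, ⟨D, ⟨i⟩, -, hD⟩⟩ := hK mu
    have hε : ∀ (nu : Λ) (f : H.L nu →ₗ[A] D.obj), f ≠ 0 → l nu ≡ l mu [ZMOD 2] := by
      intro nu f hf
      rw [H.eq_of_hom_L_nabla (linear_from_ne_zero_of_iso i hf)]
    by_contra hcon
    refine hx (ext_eq_zero_of_iso_right i (fun y => ?_) x)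
    by_contra hy
    have := parity_of_isColinear hA₀ hExt hD hε p lam y hy
    simp only [Int.ModEq] at this hcon
    lia

end Main

end HWParity

theorem mainTheorem7
    {k : Type u'} [Field k] [IsAlgClosed k]
    {A : Type u} [Ring A] [Algebra k A] [FiniteDimensional k A] [IsNoetherianRing A]
    (𝒜 : ℕ → Submodule k A) [GradedAlgebra 𝒜] (hA₀ : IsSemisimpleRing (𝒜 0))
    [HasExt.{w} (FGModuleCat.{u} A)] [HasDerivedCategory.{w'} (FGModuleCat.{u} A)]
    {Λ : Type v} [Finite Λ] [PartialOrder Λ]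
    (H : HWParity.HighestWeight (FGModuleCat.{u} A) Λ) (l : Λ → ℤ)
    (hExt : ∀ lam₁ lam₂ : Λ, l lam₁ ≡ l lam₂ [ZMOD 2] →
      Subsingleton (Ext (H.L lam₁) (H.L lam₂) 1)) :
    (∀ M : FGModuleCat.{u} A, HWParity.HasLinearLift 𝒜 M →
      (Indecomposable M ∨ HWParity.HasHeadOfOneParity H l M) → HWParity.HasParity H M) ∧
    (HWParity.IsStandardKoszul 𝒜 H → HWParity.HasKLTheory H l) := by
  have : IsArtinianRing A := IsArtinianRing.of_finite k A
  exact ⟨fun _ hM h => HWParity.hasParity_of_linear hA₀ hExt hM h,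
    fun hK => HWParity.hasKLTheory_of_standardKoszul hA₀ hExt hK⟩
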